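/- For $n\ge 0$ let $\mathcal P_n$ be the set of set partitions of $[n]=\{1,\dots,n\}$. An \emph{arc} of $P\in\mathcal P_n$ is a pair $(i,j)$, $i<j$, of elements of the same block of $P$ such that no element strictly between $i$ and $j$ belongs to that block. A partition $P$ \emph{avoids} a permutation $\tau$ of $[k]$ if there are no $2k$ elements $i_1<\dots<i_{2k}$ of $[n]$ such that $(i_a,i_{2k+1-\tau(a)})$ is an arc of $P$ for every $1\le a\le k$. Let $\mathcal P_n(312)$ be the set of $P\in\mathcal P_n$ that avoid $312$ (the permutation $\tau(1)=3$, $\tau(2)=1$, $\tau(3)=2$), and let $$B(z)=\sum_{n\ge 0}|\mathcal P_n(312)|\,z^n\in\mathbb Q[[z]].$$ \textbf{Theorem.} The power series $B=B(z)$ is a root of the cubic polynomial \begin{align*}&(z-1)(5z^2-2z+1)^2B^3+(-9z^5+54z^4-85z^3+59z^2-14z+3)B^2\\&\quad+(-9z^4+60z^3-64z^2+13z-3)B+(-9z^3+23z^2-4z+1);\end{align*} in particular $B$ is algebraic over $\mathbb Q[z]$. Moreover there is a constant $\delta$ such that, as $n\to\infty$, $$|\mathcal P_n(312)|\sim\delta\,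 n^{-5/2}\rho^n,\qquad \rho=\frac{3(9+6\sqrt3)^{1/3}}{3+2(9+6\sqrt3)^{1/3}-(9+6\sqrt3)^{2/3}}\approx 6.97685,$$ with $\delta\approx 0.0614865$; precisely, $|\rho-6.97685|<5\cdot10^{-6}$ and $|\delta-0.0614865|<5\cdot10^{-8}$. -/

import Mathlib

noncomputable section

namespace SetPartitionPattern

/-- The arc diagram of a partition `P` of the linearly ordered set `Fin n`: `(i, j)` is an arc when
`i < j` are two consecutive elements of the same block of `P`. -/
def IsArc {n : ℕ} (P : Finpartition (Finset.univ : Finset (Fin n))) (i j : Fin n) : Prop :=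
  i < j ∧ j ∈ P.part i ∧ ∀ l : Fin n, i < l → l < j → l ∉ P.part i

/-- The inclusion of `Fin k` in `Fin (2 * k)` as the first `k` indices: the arcs of an occurrence
of a pattern of length `k` open at the first `k` of its `2 * k` vertices. -/
def leftIndex {k : ℕ} (a : Fin k) : Fin (2 * k) :=
  Fin.castLE (Nat.le_mul_of_pos_left k Nat.two_pos) a

/-- `P` avoids `τ` when there are no vertices `i₁ < ⋯ < i₂ₖ` such that `P` contains all the arcs
`(iₐ, i_{2k+1-τ(a)})`, `1 ≤ a ≤ k`. Indices are counted from `0` here, and `Fin.rev` sends the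
`t`-th index from the left to the `t`-th index from the right. -/
def Avoids {n k : ℕ} (P : Finpartition (Finset.univ : Finset (Fin n)))
    (τ : Equiv.Perm (Fin k)) : Prop :=
  ¬ ∃ v : Fin (2 * k) → Fin n, StrictMono v ∧
    ∀ a : Fin k, IsArc P (v (leftIndex a)) (v (Fin.rev (leftIndex (τ a))))

/-- The number of partitions of an `n`-element linearly ordered set that avoid `τ`. -/
def numAvoiding {k : ℕ} (τ : Equiv.Perm (Fin k)) (n : ℕ) : ℕ :=
  Nat.card {P : Finpartition (Finset.univ : Finset (Fin n)) // Avoids P τ}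

/-- The permutation `312` in one-line notation, with values counted from `0`. -/
def perm312 : Equiv.Perm (Fin 3) where
  toFun := ![2, 0, 1]
  invFun := ![1, 2, 0]
  left_inv := by decide
  right_inv := by decide

/-- The ordinary generating function `B(z)` of the partitions that avoid `312`. -/
def genFun312 : PowerSeries ℚ :=
  PowerSeries.mk fun n => (numAvoiding perm312 n : ℚ)

open Polynomial in
/-- The cubic polynomial in the outer variable (standing for `B`), with coefficients that are
polynomials in the inner variable `z`. -/
def cubic312 : Polynomial (Polynomial ℚ) :=
  let z : Polynomial ℚ := X
  C ((z - 1) * (5 * z ^ 2 - 2 * z + 1) ^ 2) * X ^ 3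
    + C (-9 * z ^ 5 + 54 * z ^ 4 - 85 * z ^ 3 + 59 * z ^ 2 - 14 * z + 3) * X ^ 2
    + C (-9 * z ^ 4 + 60 * z ^ 3 - 64 * z ^ 2 + 13 * z - 3) * X
    + C (-9 * z ^ 3 + 23 * z ^ 2 - 4 * z + 1)

/-- The exponential growth rate. -/
def rho312 : ℝ :=
  3 * (9 + 6 * √3) ^ (1 / 3 : ℝ) /
    (3 + 2 * (9 + 6 * √3) ^ (1 / 3 : ℝ) - (9 + 6 * √3) ^ (2 / 3 : ℝ))

end SetPartitionPattern

end

/-!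
Read the arc diagram of a partition that avoids `312` from left to right. When an open arc is
closed, all arcs that were opened after it and are still open have to be closed in the order in
which they were opened. Hence the open arcs, in order of opening, fall into consecutive blocks, in
each of which only the first arc may be closed next: opening an arc adds a block of size one at
the end, and closing the first arc of a block merges the rest of that block with all later blocks.
So only the list of block sizes matters (`numAvoiding_eq_walkCount`). Adding the vertices of a
partition one by one leads to a similar count, `growthCount`, in which the states list all
vertices that may still get a right neighbour in their block; selecting those that do get one
turns it into the count of walks (`growthCount_eq_selectSum`).

The walks on lists of block sizes are decomposed by levels, the level being the number of open
arcs. An excursion above a level erases some of the topmost block boundaries below that level, and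
the number of excursions depends only on how many it erases. With `x` marking the erased
boundaries, the generating function `E(x)` of the excursions satisfies a quadratic equation in
which `e = E(0)` is unknown too (`excursion_quadratic`), and the generating function `B` is a
rational function of `e` (`genFun312_eq`).

The quadratic method (`exists_critical_point`) solves this equation. Formally, `x` and `E` are
reduced modulo the series `2 z E - b`, which by Weierstrass division amounts to evaluating them at
its zero. At that point the quadratic polynomial and its two partial derivatives vanish. These
three equations define a rational curve: there is a series `s` with `s = z (1 + 2 s) (1 + s + s²)`
and `B = 1 + s / ((1 + s) (1 + s²)²)` (`exists_parametrization`). The cubic equation is an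
identity in `s`.

With `Φ(t) = (1 + 2 t) (1 + t + t²)`, Lagrange inversion expresses the coefficients of `B` by
those of the powers of `Φ`. The derivative of `s / ((1 + s) (1 + s²)²)` has the factor `Φ - t Φ'`,
and an integration by parts leads to `(m + 1) (m + 2) [zᵐ⁺¹] B = [tᵐ] W(t) Φ(t)ᵐ⁺²`, where `W` is
rational with poles on the unit circle (`numAvoiding_eq_coeff`). The saddle point is the positive
root `r` of `4 t³ + 3 t² = 1`: the probability distribution with weights proportional to the
coefficients of `Φ(r t)` has mean one, so the local limit theorem (`tendsto_sqrt_mul_coeff`) gives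
the order `n ^ (-1 / 2)` for the coefficients of the powers, hence `n ^ (-5 / 2)` for those of
`B`. The growth rate is `Φ(r) / r` and the constant is `3 r / (8 (1 + r²)³ √(π (1 - r²)))`.
-/

noncomputable section

namespace SetPartitionPattern

section Diagrams

open Finset Relation

/-! ### Partitions as arc diagrams -/

/-- The arc sets of set partitions of `{0, …, n - 1}`: every arc goes from left to right, and no two
arcs share their left end or share their right end. -/
structure IsDiagram (n : ℕ) (A : Finset (ℕ × ℕ)) : Prop where
  lt : ∀ i j, (i, j) ∈ A → i < j
  lt_size : ∀ i j, (i, j) ∈ A → j < n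
  right_unique : ∀ i j k, (i, j) ∈ A → (i, k) ∈ A → j = k
  left_unique : ∀ i j k, (i, k) ∈ A → (j, k) ∈ A → i = j

/-- The arc set `A` contains the pattern `312`. -/
def Has312 (A : Finset (ℕ × ℕ)) : Prop :=
  ∃ a b c d e f : ℕ, a < b ∧ b < c ∧ c < d ∧ d < e ∧ e < f ∧ (a, d) ∈ A ∧ (b, f) ∈ A ∧ (c, e) ∈ A

open Classical in
/-- The arc diagrams on `n` vertices that avoid `312`. -/
def diagrams (n : ℕ) : Finset (Finset (ℕ × ℕ)) :=
  (range n ×ˢ range n).powerset.filter fun A => IsDiagram n A ∧ ¬ Has312 A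

theorem IsDiagram.subset {n : ℕ} {A : Finset (ℕ × ℕ)} (h : IsDiagram n A) :
    A ⊆ range n ×ˢ range n := by
  rintro ⟨i, j⟩ hij
  have := h.lt i j hij
  have := h.lt_size i j hij
  simp only [mem_product, mem_range]
  omega

theorem mem_diagrams {n : ℕ} {A : Finset (ℕ × ℕ)} :
    A ∈ diagrams n ↔ IsDiagram n A ∧ ¬ Has312 A := by
  simp only [diagrams, mem_filter, mem_powerset, and_iff_right_iff_imp]
  exact fun h => h.1.subset

section Arcs

variable {n : ℕ}

open Classical in
/-- The set of arcs of a partition, with vertices read as natural numbers. -/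
def arcs (P : Finpartition (univ : Finset (Fin n))) : Finset (ℕ × ℕ) :=
  (univ.filter fun p : Fin n × Fin n => IsArc P p.1 p.2).image fun p => (p.1.val, p.2.val)

theorem mem_arcs {P : Finpartition (univ : Finset (Fin n))} {i j : ℕ} :
    (i, j) ∈ arcs P ↔ ∃ (hi : i < n) (hj : j < n), IsArc P ⟨i, hi⟩ ⟨j, hj⟩ := by
  simp only [arcs, mem_image, mem_filter, mem_univ, true_and, Prod.exists, Prod.mk.injEq]
  constructor
  · rintro ⟨a, b, h, rfl, rfl⟩
    exact ⟨a.2, b.2, h⟩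
  · rintro ⟨hi, hj, h⟩
    exact ⟨_, _, h, rfl, rfl⟩

theorem mem_arcs_val {P : Finpartition (univ : Finset (Fin n))} {i j : Fin n} :
    (i.val, j.val) ∈ arcs P ↔ IsArc P i j := by
  rw [mem_arcs]
  exact ⟨fun ⟨_, _, h⟩ => h, fun h => ⟨i.2, j.2, h⟩⟩

theorem mem_part_comm {P : Finpartition (univ : Finset (Fin n))} {i j : Fin n} :
    j ∈ P.part i ↔ i ∈ P.part j := by
  rw [P.mem_part_iff_part_eq_part (mem_univ j) (mem_univ i),
    P.mem_part_iff_part_eq_part (mem_univ i) (mem_univ j), eq_comm]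

theorem part_eq_of_mem {P : Finpartition (univ : Finset (Fin n))} {i j : Fin n}
    (h : j ∈ P.part i) : P.part j = P.part i :=
  (P.mem_part_iff_part_eq_part (mem_univ j) (mem_univ i)).1 h

theorem isDiagram_arcs (P : Finpartition (univ : Finset (Fin n))) : IsDiagram n (arcs P) where
  lt i j h := by
    obtain ⟨hi, hj, h⟩ := mem_arcs.1 h
    exact h.1
  lt_size i j h := by
    obtain ⟨hi, hj, h⟩ := mem_arcs.1 h
    exact hj
  right_unique i j k h h' := by
    obtain ⟨hi, hj, h⟩ := mem_arcs.1 h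
    obtain ⟨_, hk, h'⟩ := mem_arcs.1 h'
    by_contra hne
    rcases Nat.lt_or_gt_of_ne hne with hlt | hlt
    · exact h'.2.2 ⟨j, hj⟩ h.1 hlt h.2.1
    · exact h.2.2 ⟨k, hk⟩ h'.1 hlt h'.2.1
  left_unique i j k h h' := by
    obtain ⟨hi, hk, h⟩ := mem_arcs.1 h
    obtain ⟨hj, _, h'⟩ := mem_arcs.1 h'
    have hij : P.part ⟨i, hi⟩ = P.part ⟨j, hj⟩ := by
      rw [← part_eq_of_mem h.2.1, ← part_eq_of_mem h'.2.1]
    by_contra hne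
    rcases Nat.lt_or_gt_of_ne hne with hlt | hlt
    · exact h.2.2 ⟨j, hj⟩ hlt h'.1 (by rw [hij]; exact P.mem_part (mem_univ _))
    · exact h'.2.2 ⟨i, hi⟩ hlt h.1 (by rw [← hij]; exact P.mem_part (mem_univ _))

/-- Two elements of a block are joined by a chain of arcs, so the blocks can be read off from the
arcs. -/
theorem mem_part_of_arcs_eq {P Q : Finpartition (univ : Finset (Fin n))} (h : arcs P = arcs Q) :
    ∀ (d : ℕ) (i j : Fin n), j.val = i.val + d → j ∈ P.part i → j ∈ Q.part i := by
  intro d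
  induction d using Nat.strong_induction_on with
  | _ d ih =>
    intro i j hij hj
    rcases Nat.eq_zero_or_pos d with rfl | hd
    · obtain rfl : j = i := Fin.ext (by omega)
      exact Q.mem_part (mem_univ _)
    · have hlt : i < j := by rw [Fin.lt_def]; omega
      have hne : ((P.part i).filter fun l => i < l).Nonempty := ⟨j, by simp [hj, hlt]⟩
      set l := ((P.part i).filter fun l => i < l).min' hne with hl
      have hmem := Finset.min'_mem _ hne
      rw [← hl, mem_filter] at hmem
      have hlj : l ≤ j := Finset.min'_le _ _ (by simp [hj, hlt])
      have harc : IsArc P i l := by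
        refine ⟨hmem.2, hmem.1, fun k hik hkl hk => ?_⟩
        exact absurd (Finset.min'_le _ k (by simp [hk, hik])) (not_le.2 hkl)
      have harc' : IsArc Q i l := by rwa [← mem_arcs_val, ← h, mem_arcs_val]
      have hil := Fin.lt_def.1 hmem.2
      have hlj' := Fin.le_def.1 hlj
      have := ih (j.val - l.val) (by omega) l j (by omega) (by rwa [part_eq_of_mem hmem.1])
      rwa [part_eq_of_mem harc'.2.1] at this

theorem arcs_injective : Function.Injective (arcs (n := n)) := by
  have key : ∀ {P Q : Finpartition (univ : Finset (Fin n))}, arcs P = arcs Q → ∀ i j,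
      j ∈ P.part i → j ∈ Q.part i := by
    intro P Q h i j hj
    rcases le_total i.val j.val with hle | hle
    · exact mem_part_of_arcs_eq h (j.val - i.val) i j (by omega) hj
    · exact mem_part_comm.1 (mem_part_of_arcs_eq h (i.val - j.val) j i (by omega)
        (mem_part_comm.1 hj))
  have key2 : ∀ {P Q : Finpartition (univ : Finset (Fin n))}, arcs P = arcs Q →
      P.parts ⊆ Q.parts := by
    intro P Q h B hB
    obtain ⟨i, hi⟩ := P.nonempty_of_mem_parts hB
    have h1 : P.part i = B := P.part_eq_of_mem hB hi
    have h2 : P.part i = Q.part i := by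
      ext j
      exact ⟨key h i j, key h.symm i j⟩
    rw [← h1, h2]
    exact Q.part_mem.2 (mem_univ i)
  intro P Q h
  exact Finpartition.ext (Subset.antisymm (key2 h) (key2 h.symm))

/-- Every diagram is the arc set of a partition, whose blocks are the chains of arcs. -/
theorem exists_arcs_eq {A : Finset (ℕ × ℕ)} (hA : IsDiagram n A) :
    ∃ P : Finpartition (univ : Finset (Fin n)), arcs P = A := by
  classical
  let R : Fin n → Fin n → Prop := fun i j => (i.val, j.val) ∈ A
  have hR : Relator.RightUnique R := fun i j k h h' => Fin.ext (hA.right_unique _ _ _ h h')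
  have hL : Relator.RightUnique (Function.swap R) :=
    fun i j k h h' => Fin.ext (hA.left_unique _ _ _ h h')
  have hle : ∀ {i j}, ReflTransGen R i j → i ≤ j := by
    intro i j h
    induction h with
    | refl => exact le_rfl
    | tail _ h ih => exact ih.trans (Fin.le_def.2 (hA.lt _ _ h).le)
  let s : Setoid (Fin n) :=
    { r := fun i j => ReflTransGen R i j ∨ ReflTransGen R j i
      iseqv := by
        refine ⟨fun i => Or.inl .refl, fun h => h.symm, ?_⟩
        rintro i j k (h | h) (h' | h')
        · exact Or.inl (h.trans h')
        · rcases ReflTransGen.total_of_right_unique hL (reflTransGen_swap.2 h)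
            (reflTransGen_swap.2 h') with h'' | h''
          · exact Or.inr (reflTransGen_swap.1 h'')
          · exact Or.inl (reflTransGen_swap.1 h'')
        · exact ReflTransGen.total_of_right_unique hR h h'
        · exact Or.inr (h'.trans h) }
  refine ⟨Finpartition.ofSetoid s, ?_⟩
  have hpart : ∀ i j, j ∈ (Finpartition.ofSetoid s).part i ↔
      (ReflTransGen R i j ∨ ReflTransGen R j i) :=
    fun i j => Finpartition.mem_part_ofSetoid_iff_rel
  have main : ∀ i j, IsArc (Finpartition.ofSetoid s) i j ↔ R i j := by
    intro i j
    constructor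
    · rintro ⟨hlt, hmem, hno⟩
      rcases (hpart i j).1 hmem with h | h
      · rcases ReflTransGen.cases_head h with rfl | ⟨l, hil, hlj⟩
        · exact absurd hlt (lt_irrefl _)
        · rcases (hle hlj).eq_or_lt with rfl | hlt'
          · exact hil
          · exact absurd ((hpart i l).2 (Or.inl (.single hil)))
              (hno l (Fin.lt_def.2 (hA.lt _ _ hil)) hlt')
      · exact absurd (hle h) (not_le.2 hlt)
    · intro h
      refine ⟨Fin.lt_def.2 (hA.lt _ _ h), (hpart i j).2 (Or.inl (.single h)), ?_⟩
      intro l hil hlj hl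
      rcases (hpart i l).1 hl with h' | h'
      · rcases ReflTransGen.cases_head h' with rfl | ⟨l', hil', hlj'⟩
        · exact absurd hil (lt_irrefl _)
        · obtain rfl := hR h hil'
          exact absurd (hle hlj') (not_le.2 hlj)
      · exact absurd (hle h') (not_le.2 hil)
  ext ⟨i, j⟩
  constructor
  · intro h
    obtain ⟨hi, hj, h⟩ := mem_arcs.1 h
    exact (main _ _).1 h
  · intro h
    have h1 := hA.lt _ _ h
    have h2 := hA.lt_size _ _ h
    exact mem_arcs.2 ⟨by omega, h2, (main _ _).2 h⟩

theorem avoids_iff_not_has312 (P : Finpartition (univ : Finset (Fin n))) :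
    Avoids P perm312 ↔ ¬ Has312 (arcs P) := by
  rw [Avoids, not_iff_not]
  constructor
  · rintro ⟨v, hv, h⟩
    have h0 := h 0
    have h1 := h 1
    have h2 := h 2
    refine ⟨v 0, v 1, v 2, v 3, v 4, v 5, ?_, ?_, ?_, ?_, ?_, mem_arcs_val.2 h0,
      mem_arcs_val.2 h1, mem_arcs_val.2 h2⟩ <;>
    exact Fin.lt_def.1 (hv (by decide))
  · rintro ⟨a, b, c, d, e, f, hab, hbc, hcd, hde, hef, h0, h1, h2⟩
    have hf := (isDiagram_arcs P).lt_size _ _ h1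
    refine ⟨![⟨a, by omega⟩, ⟨b, by omega⟩, ⟨c, by omega⟩, ⟨d, by omega⟩, ⟨e, by omega⟩,
      ⟨f, hf⟩], ?_, ?_⟩
    · rw [Fin.strictMono_iff_lt_succ]
      intro i
      fin_cases i <;> simpa [Fin.lt_def]
    · intro i
      fin_cases i
      · exact mem_arcs_val.1 h0
      · exact mem_arcs_val.1 h1
      · exact mem_arcs_val.1 h2

theorem numAvoiding_eq_card_diagrams (n : ℕ) : numAvoiding perm312 n = (diagrams n).card := by
  rw [numAvoiding, ← Nat.card_eq_finsetCard]
  refine Nat.card_eq_of_bijective (fun P => (⟨arcs P.1, mem_diagrams.2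
    ⟨isDiagram_arcs P.1, (avoids_iff_not_has312 P.1).1 P.2⟩⟩ : diagrams n)) ⟨?_, ?_⟩
  · intro P Q h
    exact Subtype.ext (arcs_injective (congrArg Subtype.val h))
  · rintro ⟨A, hA⟩
    obtain ⟨hd, hno⟩ := mem_diagrams.1 hA
    obtain ⟨P, rfl⟩ := exists_arcs_eq hd
    exact ⟨⟨P, (avoids_iff_not_has312 P).2 hno⟩, rfl⟩

end Arcs

end Diagrams

section Growth

open Finset

/-! ### Growing a diagram vertex by vertex -/

/-- The arc set `A` has an arc passing over both `a` and `b`, where `a ≤ b`. -/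
def Covers (A : Finset (ℕ × ℕ)) (a b : ℕ) : Prop :=
  ∃ i j, (i, j) ∈ A ∧ i < a ∧ b < j

/-- The vertex `b` of the diagram `A` is active: a new last vertex may be joined to `b` by an arc
without creating an occurrence of `312`. -/
structure IsActive (n : ℕ) (A : Finset (ℕ × ℕ)) (b : ℕ) : Prop where
  lt : b < n
  not_left : ∀ j, (b, j) ∉ A
  free : ∀ i d c e, (i, d) ∈ A → (c, e) ∈ A → i < b → b < c → c < d → ¬ d < e

open Classical in
/-- The set of active vertices. -/
def activeSet (n : ℕ) (A : Finset (ℕ × ℕ)) : Finset ℕ :=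
  (range n).filter (IsActive n A)

theorem mem_activeSet {n : ℕ} {A : Finset (ℕ × ℕ)} {b : ℕ} :
    b ∈ activeSet n A ↔ IsActive n A b := by
  simp only [activeSet, mem_filter, mem_range, and_iff_right_iff_imp]
  exact fun h => h.lt

theorem Has312.mono {A B : Finset (ℕ × ℕ)} (h : A ⊆ B) (hA : Has312 A) : Has312 B := by
  obtain ⟨a, b, c, d, e, f, h1, h2, h3, h4, h5, h6, h7, h8⟩ := hA
  exact ⟨a, b, c, d, e, f, h1, h2, h3, h4, h5, h h6, h h7, h h8⟩

section Insert

variable {n : ℕ} {A : Finset (ℕ × ℕ)}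

theorem IsDiagram.not_mem_last (hA : IsDiagram n A) (b : ℕ) : (b, n) ∉ A :=
  fun h => lt_irrefl _ (hA.lt_size _ _ h)

theorem IsDiagram.succ (hA : IsDiagram n A) : IsDiagram (n + 1) A :=
  ⟨hA.lt, fun i j h => (hA.lt_size i j h).trans (Nat.lt_succ_self n), hA.right_unique,
    hA.left_unique⟩

theorem IsDiagram.insert (hA : IsDiagram n A) {b : ℕ} (hb : b < n) (hl : ∀ j, (b, j) ∉ A) :
    IsDiagram (n + 1) (insert (b, n) A) where
  lt i j h := by
    rcases mem_insert.1 h with h | h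
    · obtain ⟨rfl, rfl⟩ := Prod.mk.injEq .. ▸ h
      exact hb
    · exact hA.lt i j h
  lt_size i j h := by
    rcases mem_insert.1 h with h | h
    · obtain ⟨rfl, rfl⟩ := Prod.mk.injEq .. ▸ h
      exact Nat.lt_succ_self _
    · exact (hA.lt_size i j h).trans (Nat.lt_succ_self n)
  right_unique i j k h h' := by
    simp only [mem_insert, Prod.mk.injEq] at h h'
    rcases h with ⟨rfl, rfl⟩ | h <;> rcases h' with ⟨h1, rfl⟩ | h'
    · rfl
    · exact absurd h' (hl k)
    · subst h1
      exact absurd h (hl j)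
    · exact hA.right_unique i j k h h'
  left_unique i j k h h' := by
    simp only [mem_insert, Prod.mk.injEq] at h h'
    rcases h with ⟨rfl, rfl⟩ | h <;> rcases h' with ⟨rfl, h1⟩ | h'
    · rfl
    · exact absurd h' (hA.not_mem_last j)
    · subst h1
      exact absurd h (hA.not_mem_last i)
    · exact hA.left_unique i j k h h'

theorem IsDiagram.of_subset {B : Finset (ℕ × ℕ)} (hA : IsDiagram (n + 1) A) (h : B ⊆ A)
    (hn : ∀ b, (b, n) ∉ B) : IsDiagram n B where
  lt i j hij := hA.lt i j (h hij)
  lt_size i j hij := by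
    have h1 := hA.lt_size i j (h hij)
    have h2 : j ≠ n := by
      rintro rfl
      exact hn i hij
    omega
  right_unique i j k hij hik := hA.right_unique i j k (h hij) (h hik)
  left_unique i j k hij hik := hA.left_unique i j k (h hij) (h hik)

/-- A new arc ending at the last vertex can only play the part of the arc that closes last. -/
theorem insert_mem_diagrams (hA : A ∈ diagrams n) {b : ℕ} (hb : IsActive n A b) :
    insert (b, n) A ∈ diagrams (n + 1) := by
  obtain ⟨hA, hno⟩ := mem_diagrams.1 hA
  refine mem_diagrams.2 ⟨hA.insert hb.lt hb.not_left, ?_⟩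
  rintro ⟨x1, x2, x3, x4, x5, x6, h1, h2, h3, h4, h5, h6, h7, h8⟩
  have hlt : x6 < n + 1 := (hA.insert hb.lt hb.not_left).lt_size _ _ h7
  have h6' : (x1, x4) ∈ A := by
    rcases mem_insert.1 h6 with h | h
    · simp only [Prod.mk.injEq] at h
      omega
    · exact h
  have h8' : (x3, x5) ∈ A := by
    rcases mem_insert.1 h8 with h | h
    · simp only [Prod.mk.injEq] at h
      omega
    · exact h
  rcases mem_insert.1 h7 with h | h
  · simp only [Prod.mk.injEq] at h
    obtain ⟨rfl, rfl⟩ := h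
    exact hb.free _ _ _ _ h6' h8' h1 h2 h3 h4
  · exact hno ⟨x1, x2, x3, x4, x5, x6, h1, h2, h3, h4, h5, h6', h, h8'⟩

theorem isActive_of_insert_mem (hA : IsDiagram n A) {b : ℕ}
    (h : insert (b, n) A ∈ diagrams (n + 1)) : IsActive n A b := by
  obtain ⟨hd, hno⟩ := mem_diagrams.1 h
  refine ⟨hd.lt _ _ (mem_insert_self _ _), fun j hj => ?_, fun i d c e h1 h2 h3 h4 h5 h6 => ?_⟩
  · have := hd.right_unique _ _ _ (mem_insert_self _ _) (mem_insert_of_mem hj)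
    subst this
    exact hA.not_mem_last _ hj
  · exact hno ⟨i, b, c, d, e, n, h3, h4, h5, h6, hA.lt_size _ _ h2, mem_insert_of_mem h1,
      mem_insert_self _ _, mem_insert_of_mem h2⟩

end Insert

/-- A diagram on `n + 1` vertices is obtained from one on `n` vertices by adding an isolated last
vertex, or a last vertex that is joined to an active one. -/
theorem sum_diagrams_succ (n : ℕ) (F : Finset (ℕ × ℕ) → ℕ) :
    ∑ A ∈ diagrams (n + 1), F A =
      ∑ A ∈ diagrams n, (F A + ∑ b ∈ activeSet n A, F (insert (b, n) A)) := by
  classical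
  rw [← sum_filter_not_add_sum_filter (diagrams (n + 1)) (fun A => ∃ b, (b, n) ∈ A),
    sum_add_distrib]
  congr 1
  · refine sum_congr ?_ fun _ _ => rfl
    ext A
    simp only [mem_filter, mem_diagrams, not_exists]
    exact ⟨fun ⟨⟨h, hno⟩, hn⟩ => ⟨h.of_subset Subset.rfl hn, hno⟩,
      fun ⟨h, hno⟩ => ⟨⟨h.succ, hno⟩, h.not_mem_last⟩⟩
  · rw [Finset.sum_sigma']
    symm
    refine Finset.sum_nbij (fun x => insert (x.2, n) x.1) ?_ ?_ ?_ fun _ _ => rfl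
    · rintro ⟨A, b⟩ h
      simp only [mem_sigma, mem_activeSet] at h
      exact mem_filter.2 ⟨insert_mem_diagrams h.1 h.2, b, mem_insert_self _ _⟩
    · rintro ⟨A, b⟩ h ⟨A', b'⟩ h' heq
      simp only [coe_sigma, Set.mem_sigma_iff, mem_coe, mem_activeSet] at h h'
      have hA := (mem_diagrams.1 h.1).1
      have hA' := (mem_diagrams.1 h'.1).1
      have heq : insert (b, n) A = insert (b', n) A' := heq
      have hb : b = b' := by
        have : (b, n) ∈ insert (b', n) A' := heq ▸ mem_insert_self _ _
        rcases mem_insert.1 this with h | h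
        · exact (Prod.mk.inj h).1
        · exact absurd h (hA'.not_mem_last b)
      subst hb
      have : A = A' := by
        rw [← erase_insert (hA.not_mem_last b), heq, erase_insert (hA'.not_mem_last b)]
      subst this
      rfl
    · intro A h
      obtain ⟨h, b, hb⟩ := mem_filter.1 (mem_coe.1 h)
      obtain ⟨hd, hno⟩ := mem_diagrams.1 h
      have hB : IsDiagram n (A.erase (b, n)) := hd.of_subset (erase_subset _ _) fun c hc => by
        have := hd.left_unique _ _ _ hb (mem_of_mem_erase hc)
        subst this
        exact notMem_erase _ _ hc
      refine ⟨⟨A.erase (b, n), b⟩, ?_, insert_erase hb⟩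
      simp only [coe_sigma, Set.mem_sigma_iff, mem_coe, mem_activeSet]
      refine ⟨mem_diagrams.2 ⟨hB, fun h312 => hno (h312.mono (erase_subset _ _))⟩, ?_⟩
      exact isActive_of_insert_mem hB (by rwa [insert_erase hb])

/-- The number of ways to add `m` further vertices to a diagram on `n` vertices. -/
def extensionCount : ℕ → ℕ → Finset (ℕ × ℕ) → ℕ
  | 0, _, _ => 1
  | m + 1, n, A => extensionCount m (n + 1) A +
      ∑ b ∈ activeSet n A, extensionCount m (n + 1) (insert (b, n) A)

theorem card_diagrams_add (m n : ℕ) :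
    (diagrams (n + m)).card = ∑ A ∈ diagrams n, extensionCount m n A := by
  induction m generalizing n with
  | zero => simp [extensionCount]
  | succ m ih =>
    rw [show n + (m + 1) = n + 1 + m by omega, ih, sum_diagrams_succ]
    rfl

theorem card_diagrams (n : ℕ) : (diagrams n).card = extensionCount n 0 ∅ := by
  have h := card_diagrams_add n 0
  rw [Nat.zero_add] at h
  rw [h]
  have h0 : diagrams 0 = {∅} := by
    ext A
    rw [mem_diagrams, mem_singleton]
    constructor
    · rintro ⟨h, -⟩
      exact subset_empty.1 (h.subset.trans (by simp))
    · rintro rfl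
      exact ⟨⟨by simp, by simp, by simp, by simp⟩, by simp [Has312]⟩
  rw [h0, sum_singleton]

/-! ### The states of the growth process -/

section Lists

variable {α : Type*}

/-- Puts a block of size `k` in front of a list of block sizes, unless the block is empty. -/
def pushBlock (k : ℕ) (L : List ℕ) : List ℕ := if k = 0 then L else k :: L

@[simp] theorem pushBlock_zero (L : List ℕ) : pushBlock 0 L = L := rfl

@[simp] theorem pushBlock_succ (k : ℕ) (L : List ℕ) : pushBlock (k + 1) L = (k + 1) :: L := rfl

/-- The sum of `g` over the states reached by joining a new vertex to an active one, with the block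
of the new vertex left out. When an element of a block is chosen, it is lost together with the
earlier elements of the block, and the later elements of the block are merged with all later
blocks, which have `a` elements. -/
def attachSum (g : List ℕ → ℕ) : ℕ → List ℕ → ℕ
  | _, [] => 0
  | a, c :: L => ∑ p ∈ range c, g (pushBlock (a + p) L) + attachSum g (a + c) L

/-- The number of ways to add `m` vertices to a diagram, in terms of the sizes of the blocks of
active vertices, latest block first. -/
def growthCount : ℕ → List ℕ → ℕ
  | 0, _ => 1
  | m + 1, L => growthCount m (1 :: L) + attachSum (fun L' => growthCount m (1 :: L')) 0 L

theorem sum_map_eq_sum_range (F : α → ℕ) (B : List α) (h : ℕ → ℕ)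
    (hF : ∀ B₁ b B₂, B = B₁ ++ b :: B₂ → F b = h B₁.length) :
    (B.map F).sum = ∑ p ∈ range B.length, h p := by
  induction B generalizing h with
  | nil => simp
  | cons b B ih =>
    rw [List.map_cons, List.sum_cons, List.length_cons, sum_range_succ',
      ih (fun p => h (p + 1)) fun B₁ b' B₂ hB => ?_, hF [] b B rfl, add_comm]
    · rfl
    · rw [hF (b :: B₁) b' B₂ (by rw [hB]; rfl), List.length_cons]

theorem sum_map_flatten (F : α → ℕ) (g : List ℕ → ℕ) (L : List (List α)) (a : ℕ)
    (hF : ∀ L₁ B₁ b B₂ L₂, L = L₁ ++ (B₁ ++ b :: B₂) :: L₂ →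
      F b = g (pushBlock (a + (L₁.flatten.length + B₁.length)) (L₂.map List.length))) :
    (L.flatten.map F).sum = attachSum g a (L.map List.length) := by
  induction L generalizing a with
  | nil => simp [attachSum]
  | cons B L ih =>
    rw [List.flatten_cons, List.map_append, List.sum_append, List.map_cons, attachSum]
    congr 1
    · refine sum_map_eq_sum_range F B (fun p => g (pushBlock (a + p) (L.map List.length))) ?_
      intro B₁ b B₂ hB
      rw [hF [] B₁ b B₂ L (by rw [hB]; rfl)]
      simp
    · refine ih _ fun L₁ B₁ b B₂ L₂ hL => ?_
      rw [hF (B :: L₁) B₁ b B₂ L₂ (by rw [hL]; rfl)]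
      simp [add_assoc]

end Lists

/-- The list of lists `L` is the state of the diagram `A`: it lists the active vertices in
decreasing order, and two of them are in the same block exactly when an arc passes over both. -/
structure IsState (n : ℕ) (A : Finset (ℕ × ℕ)) (L : List (List ℕ)) : Prop where
  ne_nil : ∀ B ∈ L, B ≠ []
  mem_iff : ∀ b, b ∈ L.flatten ↔ IsActive n A b
  block : ∀ B ∈ L, B.Pairwise fun x y => y < x ∧ Covers A y x
  sep : L.Pairwise fun B C => ∀ x ∈ B, ∀ y ∈ C, y < x ∧ ¬ Covers A y x

theorem IsState.sum_activeSet {n : ℕ} {A : Finset (ℕ × ℕ)} {L : List (List ℕ)}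
    (h : IsState n A L) (F : ℕ → ℕ) : ∑ b ∈ activeSet n A, F b = (L.flatten.map F).sum := by
  have hp : L.flatten.Pairwise fun x y => y < x :=
    List.pairwise_flatten.2 ⟨fun B hB => (h.block B hB).imp fun h => h.1,
      h.sep.imp fun h x hx y hy => (h x hx y hy).1⟩
  have hnd : L.flatten.Nodup := hp.imp fun h => h.ne'
  rw [← List.sum_toFinset F hnd]
  refine sum_congr ?_ fun _ _ => rfl
  ext b
  rw [mem_activeSet, List.mem_toFinset, h.mem_iff]

/-- Adding an isolated vertex adds a block of size one. -/
theorem IsState.succ {n : ℕ} {A : Finset (ℕ × ℕ)} {L : List (List ℕ)} (hA : IsDiagram n A)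
    (h : IsState n A L) : IsState (n + 1) A ([n] :: L) where
  ne_nil B hB := by
    rcases List.mem_cons.1 hB with rfl | hB
    · simp
    · exact h.ne_nil B hB
  mem_iff b := by
    rw [List.flatten_cons, List.mem_append, h.mem_iff, List.mem_singleton]
    constructor
    · rintro (rfl | hb)
      · refine ⟨Nat.lt_succ_self _, fun j hj => ?_, fun i d c e h1 h2 h3 h4 h5 => ?_⟩
        · have := hA.lt _ _ hj
          have := hA.lt_size _ _ hj
          omega
        · have := hA.lt_size _ _ h1
          omega
      · exact ⟨hb.lt.trans (Nat.lt_succ_self n), hb.not_left, hb.free⟩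
    · intro hb
      rcases Nat.lt_succ_iff_lt_or_eq.1 hb.lt with hlt | rfl
      · exact Or.inr ⟨hlt, hb.not_left, hb.free⟩
      · exact Or.inl rfl
  block B hB := by
    rcases List.mem_cons.1 hB with rfl | hB
    · exact List.pairwise_singleton _ _
    · exact h.block B hB
  sep := by
    refine List.pairwise_cons.2 ⟨fun C hC x hx y hy => ?_, h.sep⟩
    rw [List.mem_singleton] at hx
    subst hx
    refine ⟨((h.mem_iff y).1 (List.mem_flatten.2 ⟨C, hC, hy⟩)).lt, ?_⟩
    rintro ⟨i, j, hij, -, hj⟩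
    have := hA.lt_size _ _ hij
    omega

/-- Joining the new vertex `n` to the active vertex `b` removes `b` and the earlier elements of its
block, and merges all later active vertices into one block. -/
theorem IsState.attach {n : ℕ} {A : Finset (ℕ × ℕ)} {L₁ L₂ : List (List ℕ)} {B₁ B₂ : List ℕ}
    {b : ℕ} (hA : IsDiagram n A) (h : IsState n A (L₁ ++ (B₁ ++ b :: B₂) :: L₂)) :
    IsState (n + 1) (insert (b, n) A)
      ([n] :: if L₁.flatten ++ B₁ = [] then L₂ else (L₁.flatten ++ B₁) :: L₂) := by
  set C := L₁.flatten ++ B₁ with hC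
  have hpw := h.sep
  rw [List.pairwise_append, List.pairwise_cons] at hpw
  obtain ⟨hsep1, ⟨hsepB, hsep2⟩, hsep12⟩ := hpw
  have hblock := h.block (B₁ ++ b :: B₂) (by simp)
  rw [List.pairwise_append, List.pairwise_cons] at hblock
  obtain ⟨hB1, ⟨hbB2, hB2⟩, hB12⟩ := hblock
  have hact : ∀ x, IsActive n A x ↔ (x ∈ C ∨ x = b ∨ x ∈ B₂ ∨ x ∈ L₂.flatten) := by
    intro x
    rw [← h.mem_iff, hC]
    simp only [List.flatten_append, List.flatten_cons, List.mem_append, List.mem_cons]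
    tauto
  have hb : IsActive n A b := (hact b).2 (by simp)
  -- `C` lies to the right of `b`; the blocks in `L₂` lie to its left, with no arc over them and `b`
  have hCgt : ∀ x ∈ C, b < x := by
    intro x hx
    rcases List.mem_append.1 hx with hx | hx
    · obtain ⟨D, hD, hx⟩ := List.mem_flatten.1 hx
      exact (hsep12 D hD _ List.mem_cons_self x hx b (by simp)).1
    · exact (hB12 x hx b (by simp)).1
  have hLlt : ∀ x ∈ L₂.flatten, x < b ∧ ¬ Covers A x b := by
    intro x hx
    obtain ⟨D, hD, hx⟩ := List.mem_flatten.1 hx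
    exact hsepB D hD b (by simp) x hx
  have hCL : ∀ x ∈ C, ∀ y ∈ L₂.flatten, y < x ∧ ¬ Covers A y x := by
    intro x hx y hy
    obtain ⟨D, hD, hy⟩ := List.mem_flatten.1 hy
    rcases List.mem_append.1 hx with hx | hx
    · obtain ⟨E, hE, hx⟩ := List.mem_flatten.1 hx
      exact hsep12 E hE D (by simp [hD]) x hx y hy
    · exact hsepB D hD x (by simp [hx]) y hy
  have hcov : ∀ x y, y < b → (Covers (insert (b, n) A) y x ↔ Covers A y x) := by
    intro x y hy
    constructor
    · rintro ⟨i, j, hij, h1, h2⟩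
      rcases mem_insert.1 hij with hij | hij
      · simp only [Prod.mk.injEq] at hij
        omega
      · exact ⟨i, j, hij, h1, h2⟩
    · rintro ⟨i, j, hij, h1, h2⟩
      exact ⟨i, j, mem_insert_of_mem hij, h1, h2⟩
  have hCact : ∀ x ∈ C, IsActive n A x := fun x hx => (hact x).2 (Or.inl hx)
  have hLact : ∀ x ∈ L₂.flatten, IsActive n A x :=
    fun x hx => (hact x).2 (Or.inr (Or.inr (Or.inr hx)))
  -- the active vertices of the new diagram
  have hnew : ∀ x, IsActive (n + 1) (insert (b, n) A) x ↔
      (x = n ∨ x ∈ C ∨ x ∈ L₂.flatten) := by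
    intro x
    constructor
    · intro hx
      rcases Nat.lt_succ_iff_lt_or_eq.1 hx.lt with hlt | rfl
      swap
      · exact Or.inl rfl
      have hx' : IsActive n A x := by
        refine ⟨hlt, fun j hj => hx.not_left j (mem_insert_of_mem hj), ?_⟩
        intro i d c e h1 h2
        exact hx.free i d c e (mem_insert_of_mem h1) (mem_insert_of_mem h2)
      rcases (hact x).1 hx' with h1 | rfl | h1 | h1
      · exact Or.inr (Or.inl h1)
      · exact absurd (mem_insert_self _ _) (hx.not_left n)
      · obtain ⟨hxb, i, j, hij, hix, hbj⟩ := hbB2 x h1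
        exact absurd (hA.lt_size _ _ hij)
          (hx.free i j b n (mem_insert_of_mem hij) (mem_insert_self _ _) hix hxb hbj)
      · exact Or.inr (Or.inr h1)
    · have key : ∀ x, IsActive n A x → x ≠ b → (x < b → ¬ Covers A x b) →
          IsActive (n + 1) (insert (b, n) A) x := by
        intro x hx hne hc
        refine ⟨hx.lt.trans (Nat.lt_succ_self n), fun j hj => ?_, ?_⟩
        · rcases mem_insert.1 hj with hj | hj
          · exact hne (Prod.mk.inj hj).1
          · exact hx.not_left j hj
        · intro i d c e h1 h2 h3 h4 h5 h6
          have hsize : e < n + 1 := (hA.insert hb.lt hb.not_left).lt_size _ _ h2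
          have h1' : (i, d) ∈ A := by
            rcases mem_insert.1 h1 with h | h
            · simp only [Prod.mk.injEq] at h
              omega
            · exact h
          rcases mem_insert.1 h2 with h | h
          · simp only [Prod.mk.injEq] at h
            obtain ⟨rfl, rfl⟩ := h
            exact hc h4 ⟨i, d, h1', h3, h5⟩
          · exact hx.free i d c e h1' h h3 h4 h5 h6
      rintro (rfl | hx | hx)
      · refine ⟨Nat.lt_succ_self _, fun j hj => ?_, fun i d c e h1 h2 h3 h4 h5 h6 => ?_⟩
        · have h1 := (hA.insert hb.lt hb.not_left).lt _ _ hj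
          have h2 := (hA.insert hb.lt hb.not_left).lt_size _ _ hj
          omega
        · have h2 := (hA.insert hb.lt hb.not_left).lt_size _ _ h2
          omega
      · have := hCgt x hx
        exact key x (hCact x hx) (by omega) (by omega)
      · have := hLlt x hx
        exact key x (hLact x hx) (by omega) fun _ => this.2
  have hmem : ∀ x, x ∈ (if C = [] then L₂ else C :: L₂).flatten ↔ x ∈ C ∨ x ∈ L₂.flatten := by
    intro x
    split_ifs with h0
    · simp [h0]
    · simp
  refine ⟨?_, ?_, ?_, ?_⟩
  · intro B hB
    rcases List.mem_cons.1 hB with rfl | hB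
    · simp
    split_ifs at hB with h0
    · exact h.ne_nil B (by simp [hB])
    · rcases List.mem_cons.1 hB with rfl | hB
      · exact h0
      · exact h.ne_nil B (by simp [hB])
  · intro x
    rw [hnew, List.flatten_cons, List.mem_append, hmem, List.mem_singleton]
  · have hL2 : ∀ B ∈ L₂, B.Pairwise fun x y => y < x ∧ Covers (insert (b, n) A) y x := by
      intro B hB
      refine (h.block B (by simp [hB])).imp ?_
      rintro x y ⟨h1, i, j, h2, h3⟩
      exact ⟨h1, i, j, mem_insert_of_mem h2, h3⟩
    intro B hB
    rcases List.mem_cons.1 hB with rfl | hB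
    · exact List.pairwise_singleton _ _
    split_ifs at hB with h0
    · exact hL2 B hB
    · rcases List.mem_cons.1 hB with rfl | hB
      · have hord : C.Pairwise fun x y => y < x := by
          refine List.pairwise_append.2 ⟨List.pairwise_flatten.2 ⟨fun D hD => ?_, ?_⟩, ?_, ?_⟩
          · exact (h.block D (by simp [hD])).imp fun h => h.1
          · exact hsep1.imp fun h x hx y hy => (h x hx y hy).1
          · exact hB1.imp fun h => h.1
          · intro x hx y hy
            obtain ⟨D, hD, hx⟩ := List.mem_flatten.1 hx
            exact (hsep12 D hD _ List.mem_cons_self x hx y (by simp [hy])).1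
        refine hord.imp_of_mem fun {x y} hx hy hxy => ⟨hxy, b, n, mem_insert_self _ _, hCgt y hy,
          (hCact x hx).lt⟩
      · exact hL2 B hB
  · refine List.pairwise_cons.2 ⟨fun D hD x hx y hy => ?_, ?_⟩
    · rw [List.mem_singleton] at hx
      subst hx
      have hy' := (hmem y).1 (List.mem_flatten.2 ⟨D, hD, hy⟩)
      have hyn : y < x := by
        rcases hy' with hy' | hy'
        · exact (hCact y hy').lt
        · exact (hLact y hy').lt
      refine ⟨hyn, ?_⟩
      rintro ⟨i, j, hij, -, hj⟩
      have := (hA.insert hb.lt hb.not_left).lt_size _ _ hij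
      omega
    · have hL2 : L₂.Pairwise fun B C => ∀ x ∈ B, ∀ y ∈ C,
          y < x ∧ ¬ Covers (insert (b, n) A) y x := by
        refine hsep2.imp_of_mem fun {D E} hD hE hDE x hx y hy => ?_
        rw [hcov x y (hLlt y (List.mem_flatten.2 ⟨E, hE, hy⟩)).1]
        exact hDE x hx y hy
      split_ifs with h0
      · exact hL2
      · refine List.pairwise_cons.2 ⟨fun D hD x hx y hy => ?_, hL2⟩
        have hy' := List.mem_flatten.2 ⟨D, hD, hy⟩
        rw [hcov x y (hLlt y hy').1]
        exact hCL x hx y hy'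

theorem extensionCount_eq_growthCount {n : ℕ} {A : Finset (ℕ × ℕ)} {L : List (List ℕ)} (m : ℕ)
    (hA : IsDiagram n A) (h : IsState n A L) :
    extensionCount m n A = growthCount m (L.map List.length) := by
  induction m generalizing n A L with
  | zero => rfl
  | succ m ih =>
    rw [extensionCount, growthCount, h.sum_activeSet]
    congr 1
    · exact ih hA.succ (h.succ hA)
    · refine sum_map_flatten _ _ L 0 ?_
      rintro L₁ B₁ b B₂ L₂ rfl
      have hb : IsActive n A b := (h.mem_iff b).1 (by simp)
      rw [ih (hA.insert hb.lt hb.not_left) (h.attach hA), List.map_cons, Nat.zero_add,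
        ← List.length_append, pushBlock]
      simp only [List.length_eq_zero_iff]
      split_ifs <;> rfl

theorem numAvoiding_eq_growthCount (n : ℕ) : numAvoiding perm312 n = growthCount n [] := by
  have hA : IsDiagram 0 ∅ := ⟨by simp, by simp, by simp, by simp⟩
  have hS : IsState 0 ∅ [] := ⟨by simp, fun b => ⟨by simp, fun h => absurd h.lt (by omega)⟩,
    by simp, List.Pairwise.nil⟩
  rw [numAvoiding_eq_card_diagrams, card_diagrams, extensionCount_eq_growthCount n hA hS]
  rfl

end Growth

section Selection

open Finset

/-! ### Deciding at each vertex whether it opens an arc -/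

/-- The binomial sum `∑ i ≤ a, (a choose i) t i`. -/
def binomialSum (a : ℕ) (t : ℕ → ℕ) : ℕ := ∑ i ∈ range (a + 1), a.choose i * t i

@[simp] theorem binomialSum_zero (t : ℕ → ℕ) : binomialSum 0 t = t 0 := by simp [binomialSum]

theorem binomialSum_succ (a : ℕ) (t : ℕ → ℕ) :
    binomialSum (a + 1) t = binomialSum a t + binomialSum a fun i => t (i + 1) := by
  rw [binomialSum, sum_range_succ', binomialSum, sum_range_succ' (fun i => a.choose i * t i),
    binomialSum]
  simp only [Nat.choose_succ_succ, add_mul, sum_add_distrib, Nat.choose_zero_right]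
  rw [sum_range_succ (fun i => a.choose (i + 1) * t (i + 1)) a, Nat.choose_succ_self]
  ring

theorem binomialSum_add_fun (a : ℕ) (s t : ℕ → ℕ) :
    binomialSum a (fun i => s i + t i) = binomialSum a s + binomialSum a t := by
  simp [binomialSum, mul_add, sum_add_distrib]

theorem binomialSum_binomialSum (a c : ℕ) (t : ℕ → ℕ) :
    binomialSum a (fun i => binomialSum c fun j => t (i + j)) = binomialSum (a + c) t := by
  induction a generalizing t with
  | zero => simp
  | succ a ih =>
    rw [binomialSum_succ, ih, Nat.add_right_comm, binomialSum_succ, ← ih]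
    simp only [← ih, Nat.add_right_comm]

theorem sum_binomialSum (a c : ℕ) (s : ℕ → ℕ) :
    ∑ p ∈ range c, binomialSum (a + p) s =
      binomialSum a fun i => binomialSum c fun j => if j = 0 then 0 else s (i + j - 1) := by
  induction c with
  | zero => simp [binomialSum]
  | succ c ih =>
    rw [sum_range_succ, ih, ← binomialSum_binomialSum, ← binomialSum_add_fun]
    congr 1
    funext i
    rw [binomialSum_succ]
    rfl

/-- The sum of `g` over all ways to keep some of the elements of the blocks whose sizes are listed
in `L`; blocks that become empty are dropped. -/
def selectSum : (List ℕ → ℕ) → List ℕ → ℕ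
  | g, [] => g []
  | g, c :: L => binomialSum c fun i => selectSum (fun L' => g (pushBlock i L')) L

/-- The sum of `g` over the states reached by closing an open arc: the first arc of one of the
blocks is closed, and the rest of that block is merged with all later blocks, which contain `a`
arcs. -/
def closeSum (g : List ℕ → ℕ) : ℕ → List ℕ → ℕ
  | _, [] => 0
  | a, c :: L => g (pushBlock (a + c - 1) L) + closeSum g (a + c) L

/-- The number of ways to add `m` vertices and close all arcs, starting from open arcs in blocks
whose sizes are listed in `L`, the latest block first. At each new vertex an open arc may be closed
and a new arc may be opened. -/
def walkCount : ℕ → List ℕ → ℕ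
  | 0, L => if L = [] then 1 else 0
  | m + 1, L => walkCount m L + walkCount m (1 :: L) +
      closeSum (fun L' => walkCount m L' + walkCount m (1 :: L')) 0 L

theorem selectSum_add (g h : List ℕ → ℕ) (L : List ℕ) :
    selectSum (fun L' => g L' + h L') L = selectSum g L + selectSum h L := by
  induction L generalizing g h with
  | nil => rfl
  | cons c L ih => simp only [selectSum, ih, binomialSum_add_fun]

theorem selectSum_zero (L : List ℕ) : selectSum (fun _ => 0) L = 0 := by
  induction L with
  | nil => rfl
  | cons c L ih => simp [selectSum, ih, binomialSum]

theorem selectSum_pushBlock (g : List ℕ → ℕ) (k : ℕ) (L : List ℕ) :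
    selectSum g (pushBlock k L) =
      binomialSum k fun i => selectSum (fun L' => g (pushBlock i L')) L := by
  cases k <;> simp [selectSum]

theorem selectSum_isEmpty (L : List ℕ) : selectSum (fun L' => if L' = [] then 1 else 0) L = 1 := by
  induction L with
  | nil => rfl
  | cons c L ih =>
    rw [selectSum, binomialSum, sum_eq_single_of_mem 0 (by simp) fun i _ hi => ?_]
    · rw [Nat.choose_zero_right, one_mul]
      exact ih
    · obtain ⟨i, rfl⟩ := Nat.exists_eq_succ_of_ne_zero hi
      simp [selectSum_zero]

/-- Attaching a new vertex and then selecting the vertices whose arcs will be continued amounts to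
selecting first and then closing an arc. -/
theorem attachSum_selectSum (h : List ℕ → ℕ) (a : ℕ) (L : List ℕ) :
    attachSum (selectSum h) a L = binomialSum a fun i => selectSum (closeSum h i) L := by
  induction L generalizing a with
  | nil => simp [attachSum, selectSum, closeSum, binomialSum]
  | cons c L ih =>
    have key : ∀ i j, selectSum (fun L' => closeSum h i (pushBlock j L')) L =
        (if j = 0 then 0 else selectSum (fun L' => h (pushBlock (i + j - 1) L')) L) +
          selectSum (closeSum h (i + j)) L := by
      intro i j
      cases j with
      | zero => simp
      | succ j => simp [closeSum, selectSum_add]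
    simp only [attachSum, selectSum_pushBlock, ih, selectSum, key]
    rw [sum_binomialSum, ← binomialSum_binomialSum, ← binomialSum_add_fun]
    simp only [← binomialSum_add_fun]

theorem growthCount_eq_selectSum (m : ℕ) (L : List ℕ) :
    growthCount m L = selectSum (walkCount m) L := by
  induction m generalizing L with
  | zero => exact (selectSum_isEmpty L).symm
  | succ m ih =>
    have key : ∀ L, growthCount m (1 :: L) =
        selectSum (fun L' => walkCount m L' + walkCount m (1 :: L')) L := by
      intro L
      rw [ih, selectSum, binomialSum_succ, selectSum_add]
      simp
    rw [growthCount]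
    simp only [key]
    rw [attachSum_selectSum, binomialSum_zero, ← selectSum_add]
    rfl

theorem numAvoiding_eq_walkCount (n : ℕ) : numAvoiding perm312 n = walkCount n [] := by
  rw [numAvoiding_eq_growthCount, growthCount_eq_selectSum]
  rfl

end Selection

section Walks

open Finset PowerSeries

/-! ### The generating function in terms of excursions -/

/-- The coefficient of `z ^ n` in `closedSeries m`, by the recursion `closedSeries_eq`. The factors
given by case distinction are coefficients of `excursionSeries`. -/
def closedCoeff : ℕ → ℕ → ℚ
  | 0, _ => 1
  | n + 1, m => closedCoeff n m +
      (∑ i : Fin (n + 1),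
          (if i.val = 0 then 1 else closedCoeff (i.val - 1) 0) * closedCoeff (n - i.val) m +
        ∑ q ∈ antidiagonal m, ∑ i : Fin (n + 1),
          (if i.val = 0 then 1 else closedCoeff (i.val - 1) (q.1 + 1)) *
            closedCoeff (n - i.val) q.2)
termination_by n _ => n
decreasing_by all_goals omega

/-- The generating function of the excursions above a given height that begin right after an arc
was closed and lose at most `m` of the block boundaries below that height. -/
def closedSeries (m : ℕ) : ℚ⟦X⟧ := PowerSeries.mk fun n => closedCoeff n m

/-- The generating function of all excursions above a given height that lose at most `m` of the
block boundaries below that height. -/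
def excursionSeries (m : ℕ) : ℚ⟦X⟧ := 1 + X * closedSeries m

theorem coeff_excursionSeries (n m : ℕ) :
    coeff n (excursionSeries m) = if n = 0 then 1 else closedCoeff (n - 1) m := by
  cases n <;> simp [excursionSeries, closedSeries, coeff_succ_X_mul, coeff_one]

theorem coeff_excursionSeries_mul_closedSeries (n k m : ℕ) :
    coeff n (excursionSeries k * closedSeries m) = ∑ i : Fin (n + 1),
      (if i.val = 0 then 1 else closedCoeff (i.val - 1) k) * closedCoeff (n - i.val) m := by
  rw [coeff_mul, Nat.sum_antidiagonal_eq_sum_range_succ_mk,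
    ← Fin.sum_univ_eq_sum_range
      (fun i => coeff i (excursionSeries k) * coeff (n - i) (closedSeries m))]
  simp only [coeff_excursionSeries]
  simp [closedSeries]

/-- Right after an arc was closed, either no arc is opened at the same vertex, or an arc is opened
there, followed by an excursion one level higher and the closing of an arc. The higher excursion
sees one more block boundary. The term with `excursionSeries 0` stands for the case that no boundary is
erased and the last open arc, alone in its block, is closed. -/
theorem closedSeries_eq (m : ℕ) :
    closedSeries m = excursionSeries m + X * (excursionSeries 0 * closedSeries m +
      ∑ q ∈ antidiagonal m, excursionSeries (q.1 + 1) * closedSeries q.2) := by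
  ext n
  cases n with
  | zero => simp [closedSeries, excursionSeries, closedCoeff]
  | succ n =>
    rw [map_add, coeff_succ_X_mul, coeff_excursionSeries, map_add, map_sum]
    simp only [coeff_excursionSeries_mul_closedSeries]
    rw [closedSeries, coeff_mk, closedCoeff]
    simp

/-! ### Solving the linear system for the walk counts -/

/-- The state reached from `L` by closing the first arc of the block with index `j`. -/
def step (L : List ℕ) (j : ℕ) : List ℕ := pushBlock ((L.take (j + 1)).sum - 1) (L.drop (j + 1))

theorem sum_pushBlock (k : ℕ) (L : List ℕ) : (pushBlock k L).sum = k + L.sum := by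
  cases k <;> simp

theorem pos_pushBlock {k : ℕ} {L : List ℕ} (h : ∀ c ∈ L, 0 < c) : ∀ c ∈ pushBlock k L, 0 < c := by
  cases k with
  | zero => simpa using h
  | succ k => simpa using h

theorem pushBlock_of_pos {k : ℕ} (hk : 0 < k) (L : List ℕ) : pushBlock k L = k :: L := by
  rw [pushBlock, if_neg hk.ne']

theorem closeSum_eq_sum_range (g : List ℕ → ℕ) (a : ℕ) (L : List ℕ) :
    closeSum g a L = ∑ j ∈ range L.length,
      g (pushBlock (a + (L.take (j + 1)).sum - 1) (L.drop (j + 1))) := by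
  induction L generalizing a with
  | nil => simp [closeSum]
  | cons c L ih =>
    rw [closeSum, ih, List.length_cons, sum_range_succ', add_comm]
    simp [add_assoc]

theorem closeSum_zero (g : List ℕ → ℕ) (L : List ℕ) :
    closeSum g 0 L = ∑ j ∈ range L.length, g (step L j) := by
  rw [closeSum_eq_sum_range]
  simp [step]

section Step

variable {L : List ℕ}

theorem pos_step (hL : ∀ c ∈ L, 0 < c) (j : ℕ) : ∀ c ∈ step L j, 0 < c :=
  pos_pushBlock fun c hc => hL c (List.mem_of_mem_drop hc)

theorem sum_take_pos (hL : ∀ c ∈ L, 0 < c) (h0 : L ≠ []) (j : ℕ) : 0 < (L.take (j + 1)).sum := by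
  cases L with
  | nil => exact absurd rfl h0
  | cons c L =>
    have := hL c (by simp)
    simp only [List.take_succ_cons, List.sum_cons]
    omega

theorem sum_step (hL : ∀ c ∈ L, 0 < c) (h0 : L ≠ []) (j : ℕ) : (step L j).sum + 1 = L.sum := by
  have h1 := sum_take_pos hL h0 j
  have h2 := List.sum_take_add_sum_drop L (j + 1)
  rw [step, sum_pushBlock]
  omega

/-- The state reached from `L` by merging the blocks with indices at most `j`. -/
def mergeTop (L : List ℕ) (j : ℕ) : List ℕ := (L.take (j + 1)).sum :: L.drop (j + 1)

theorem step_mergeTop (L : List ℕ) (i j : ℕ) : step (mergeTop L j) i = step L (j + i) := by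
  rw [step, mergeTop, step, List.take_succ_cons, List.drop_succ_cons, List.sum_cons, List.drop_drop,
    show j + i + 1 = (j + 1) + i by omega, List.take_add (i := j + 1) (j := i),
    List.sum_append]

theorem step_one_cons_succ (hL : ∀ c ∈ L, 0 < c) (h0 : L ≠ []) (j : ℕ) :
    step (1 :: L) (j + 1) = mergeTop L j := by
  rw [step, mergeTop, List.take_succ_cons, List.drop_succ_cons, List.sum_cons,
    Nat.add_sub_cancel_left, pushBlock_of_pos (sum_take_pos hL h0 j)]

theorem step_one_cons_zero (L : List ℕ) : step (1 :: L) 0 = L := by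
  simp [step]

theorem pos_mergeTop (hL : ∀ c ∈ L, 0 < c) (h0 : L ≠ []) (j : ℕ) : ∀ c ∈ mergeTop L j, 0 < c := by
  intro c hc
  rcases List.mem_cons.1 hc with rfl | hc
  · exact sum_take_pos hL h0 j
  · exact hL c (List.mem_of_mem_drop hc)

theorem length_mergeTop {j : ℕ} (hj : j < L.length) : (mergeTop L j).length = L.length - j := by
  rw [mergeTop, List.length_cons, List.length_drop]
  omega

end Step

section Solution

variable (y : ℚ⟦X⟧)

/-- Auxiliary form of `closedValue` by recursion on the number of open arcs. -/
def closedValueAux : ℕ → List ℕ → ℚ⟦X⟧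
  | 0, _ => y
  | h + 1, L => X * ∑ j ∈ range L.length, closedSeries j * closedValueAux h (step L j)

/-- The generating function of the walks from the state `L` to the empty state that begin right
after an arc was closed, so that a first arc may be opened at the same vertex. Here `y` is its value
at the empty state. A walk is an excursion, after which an arc is closed to go one level down. -/
def closedValue (L : List ℕ) : ℚ⟦X⟧ := closedValueAux y L.sum L

/-- The generating function of the walks from the state `L` to the empty state. -/
def walkValue (L : List ℕ) : ℚ⟦X⟧ :=
  if L = [] then 1 + X * y
  else X * ∑ j ∈ range L.length, excursionSeries j * closedValue y (step L j)

theorem closedValue_nil : closedValue y [] = y := rfl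

theorem closedValue_eq {L : List ℕ} (hL : ∀ c ∈ L, 0 < c) (h0 : L ≠ []) :
    closedValue y L = X * ∑ j ∈ range L.length, closedSeries j * closedValue y (step L j) := by
  have h : ∃ h, L.sum = h + 1 := ⟨(step L 0).sum, (sum_step hL h0 0).symm⟩
  obtain ⟨h, hh⟩ := h
  rw [closedValue, hh, closedValueAux]
  congr 1
  refine sum_congr rfl fun j _ => ?_
  rw [closedValue, show (step L j).sum = h by have := sum_step hL h0 j; omega]

theorem walkValue_eq {L : List ℕ} (hL : ∀ c ∈ L, 0 < c) :
    walkValue y L = (if L = [] then 1 else 0) +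
      X * (closedValue y L + ∑ j ∈ range L.length, closedValue y (step L j)) := by
  rw [walkValue]
  split_ifs with h0
  · subst h0
    simp [closedValue_nil]
  · rw [zero_add]
    congr 1
    rw [closedValue_eq y hL h0, mul_sum, ← sum_add_distrib]
    refine sum_congr rfl fun j _ => ?_
    rw [excursionSeries]
    ring

/-- After an arc was closed, the next arc may be opened at the same vertex or later. -/
theorem closedValue_eq_add (hy : y * (1 - X - X * excursionSeries 0) = 1) {L : List ℕ}
    (hL : ∀ c ∈ L, 0 < c) : closedValue y L = walkValue y L + walkValue y (1 :: L) := by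
  by_cases h0 : L = []
  · subst h0
    rw [walkValue, if_pos rfl, walkValue, if_neg (by simp), List.length_singleton, sum_range_one,
      step_one_cons_zero, closedValue_nil]
    linear_combination hy
  · rw [walkValue, if_neg h0, walkValue, if_neg (by simp), List.length_cons, sum_range_succ',
      step_one_cons_zero]
    set r := L.length with hr
    have h1 : ∀ j ∈ range r, excursionSeries (j + 1) * closedValue y (step (1 :: L) (j + 1)) =
        X * ∑ i ∈ range (r - j),
          excursionSeries (j + 1) * closedSeries i * closedValue y (step L (j + i)) := by
      intro j hj
      rw [step_one_cons_succ hL h0, closedValue_eq y (pos_mergeTop hL h0 j) (by simp [mergeTop]),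
        length_mergeTop (mem_range.1 hj), mul_left_comm, mul_sum]
      simp only [step_mergeTop, mul_assoc]
      rfl
    rw [sum_congr rfl h1, ← mul_sum, ← sum_range_diag_flip r
      fun j i => excursionSeries (j + 1) * closedSeries i * closedValue y (step L (j + i)),
      closedValue_eq y hL h0, ← hr]
    have h2 : ∀ m ∈ range r, ∑ k ∈ range (m + 1), excursionSeries (k + 1) * closedSeries (m - k) *
        closedValue y (step L (k + (m - k))) =
        (∑ q ∈ antidiagonal m, excursionSeries (q.1 + 1) * closedSeries q.2) *
          closedValue y (step L m) := by
      intro m _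
      rw [Nat.sum_antidiagonal_eq_sum_range_succ_mk, sum_mul]
      refine sum_congr rfl fun k hk => ?_
      rw [Nat.add_sub_cancel' (by have := mem_range.1 hk; omega)]
    rw [sum_congr rfl h2, ← mul_add]
    congr 1
    rw [← mul_assoc, mul_comm (excursionSeries 0) X, mul_assoc, ← mul_add, mul_sum,
      ← sum_add_distrib, mul_sum, ← sum_add_distrib]
    refine sum_congr rfl fun m _ => ?_
    rw [← sub_eq_zero]
    linear_combination closedValue y (step L m) * closedSeries_eq m

theorem coeff_walkValue (hy : y * (1 - X - X * excursionSeries 0) = 1) (n : ℕ) {L : List ℕ}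
    (hL : ∀ c ∈ L, 0 < c) : coeff n (walkValue y L) = walkCount n L := by
  induction n generalizing L with
  | zero =>
    rw [walkValue_eq y hL, map_add, coeff_zero_X_mul, walkCount]
    split_ifs <;> simp
  | succ n ih =>
    have hc : ∀ {L : List ℕ}, (∀ c ∈ L, 0 < c) → coeff n (closedValue y L) =
        (walkCount n L : ℚ) + walkCount n (1 :: L) := by
      intro L hL
      rw [closedValue_eq_add y hy hL, map_add, ih hL, ih (by simpa using hL)]
    rw [walkValue_eq y hL, map_add, coeff_succ_X_mul, map_add, hc hL, map_sum, walkCount,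
      closeSum_zero]
    rw [sum_congr rfl fun j _ => hc (pos_step hL j)]
    have h0 : coeff (n + 1) (if L = [] then 1 else 0 : ℚ⟦X⟧) = 0 := by
      split_ifs <;> simp [coeff_one]
    rw [h0]
    push_cast
    ring

/-- The generating function of the partitions that avoid `312`, in terms of excursions. -/
theorem genFun312_eq (hy : y * (1 - X - X * excursionSeries 0) = 1) :
    genFun312 = 1 + X * y := by
  ext n
  rw [genFun312, coeff_mk, numAvoiding_eq_walkCount, ← coeff_walkValue y hy n (by simp), walkValue,
    if_pos rfl]

end Solution

end Walks

section Parametrization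

open Finset PowerSeries

/-! ### The quadratic method -/

section LinearDivision

variable {A : Type*} [CommRing A] [IsLocalRing A] {G : A⟦X⟧}

theorem order_map_residue_eq_one (h0 : constantCoeff G ∈ IsLocalRing.maximalIdeal A)
    (h1 : IsUnit (coeff 1 G)) : (G.map (IsLocalRing.residue A)).order = 1 := by
  refine order_eq_nat.2 ⟨?_, fun i hi => ?_⟩
  · rw [coeff_map]
    exact (h1.map _).ne_zero
  · obtain rfl : i = 0 := by omega
    rw [coeff_map, coeff_zero_eq_constantCoeff_apply, IsLocalRing.residue_eq_zero_iff]
    exact h0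

theorem map_residue_ne_zero (h0 : constantCoeff G ∈ IsLocalRing.maximalIdeal A)
    (h1 : IsUnit (coeff 1 G)) : G.map (IsLocalRing.residue A) ≠ 0 := by
  intro h
  have := order_map_residue_eq_one h0 h1
  rw [h, order_zero] at this
  exact absurd this (by decide)

/-- Modulo a series whose reduction has order one, every series is congruent to a constant. -/
theorem exists_eq_mul_add_C [IsAdicComplete (IsLocalRing.maximalIdeal A) A]
    (h0 : constantCoeff G ∈ IsLocalRing.maximalIdeal A) (h1 : IsUnit (coeff 1 G)) (f : A⟦X⟧) :
    ∃ (q : A⟦X⟧) (r : A), f = G * q + C r := by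
  obtain ⟨q, r, h⟩ := exists_isWeierstrassDivision f (map_residue_ne_zero h0 h1)
  have hdeg : r.degree < 1 := by
    have h2 := h.degree_lt
    have h3 : (G.map (Ideal.Quotient.mk (IsLocalRing.maximalIdeal A))).order = 1 :=
      order_map_residue_eq_one h0 h1
    rw [h3] at h2
    exact h2
  refine ⟨q, r.coeff 0, h.eq_mul_add.trans ?_⟩
  rw [Polynomial.eq_C_of_degree_le_zero (Nat.WithBot.lt_one_iff_le_zero.1 hdeg)]
  simp

/-- A constant that is divisible by such a series vanishes. -/
theorem eq_zero_of_C_eq_mul [IsHausdorff (IsLocalRing.maximalIdeal A) A]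
    (h0 : constantCoeff G ∈ IsLocalRing.maximalIdeal A) (h1 : IsUnit (coeff 1 G)) {r : A}
    {q : A⟦X⟧} (h : C r = G * q) : r = 0 := by
  have h3 : (G.map (Ideal.Quotient.mk (IsLocalRing.maximalIdeal A))).order = 1 :=
    order_map_residue_eq_one h0 h1
  have hdiv : IsWeierstrassDivision 0 G (-q) (Polynomial.C r) := by
    refine ⟨?_, ?_⟩
    · rw [h3]
      exact Polynomial.degree_C_le.trans_lt (by decide)
    · rw [Polynomial.coe_C, h]
      ring
  exact Polynomial.C_eq_zero.1 (hdiv.eq_zero (map_residue_ne_zero h0 h1)).2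

end LinearDivision

instance isAdicComplete_maximalIdeal_powerSeries (k : Type*) [Field k] :
    IsAdicComplete (IsLocalRing.maximalIdeal k⟦X⟧) k⟦X⟧ := by
  rw [PowerSeries.maximalIdeal_eq_span_X]
  infer_instance

/-- A formal version of the quadratic method. Let `E` be a root of `z E² - b E + c`, where `b` and
`c` are quadratic polynomials in the catalytic variable `x`. The series `2 z E - b` vanishes at some
`x = x₀(z)`, and there the polynomial and both its partial derivatives vanish. -/
theorem exists_critical_point (e : ℚ⟦X⟧) (E : ℚ⟦X⟧⟦X⟧) (he : constantCoeff E = e)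
    (he1 : constantCoeff e = 1)
    (hE : C (X : ℚ⟦X⟧) * E ^ 2 - (X * (1 - X) * (1 - C (X : ℚ⟦X⟧)) +
      C (X : ℚ⟦X⟧) * (1 - X) ^ 2 * C e + C (X : ℚ⟦X⟧)) * E +
      (X * (1 - X) + C (X : ℚ⟦X⟧) * (1 - X) ^ 2 * C e) = 0) :
    ∃ x₀ ε : ℚ⟦X⟧, constantCoeff x₀ = 0 ∧ constantCoeff ε = 1 ∧
      X * ε ^ 2 - (x₀ * (1 - x₀) * (1 - X) + X * (1 - x₀) ^ 2 * e + X) * ε +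
        (x₀ * (1 - x₀) + X * (1 - x₀) ^ 2 * e) = 0 ∧
      2 * X * ε - (x₀ * (1 - x₀) * (1 - X) + X * (1 - x₀) ^ 2 * e + X) = 0 ∧
      ((1 - 2 * x₀) * (1 - X) - 2 * X * (1 - x₀) * e) * ε =
        (1 - 2 * x₀) - 2 * X * (1 - x₀) * e := by
  set Z : ℚ⟦X⟧⟦X⟧ := C (X : ℚ⟦X⟧) with hZ
  set x : ℚ⟦X⟧⟦X⟧ := X with hx
  set G : ℚ⟦X⟧⟦X⟧ := 2 * Z * E - (x * (1 - x) * (1 - Z) + Z * (1 - x) ^ 2 * C e + Z) with hG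
  have hG0 : constantCoeff G = X * (e - 1) := by
    simp only [hG, hZ, hx, map_sub, map_mul, map_add, map_pow, map_one, map_ofNat, constantCoeff_C,
      constantCoeff_X, he]
    ring
  have hd0 : d⁄dX ℚ⟦X⟧ Z = 0 := by rw [hZ, derivative_C]
  have hd1 : d⁄dX ℚ⟦X⟧ (C e) = 0 := derivative_C
  have hd2 : d⁄dX ℚ⟦X⟧ x = 1 := by rw [hx, derivative_X]
  have h4 : d⁄dX ℚ⟦X⟧ (1 : ℚ⟦X⟧⟦X⟧) = 0 := by
    rw [← map_one (C (R := ℚ⟦X⟧))]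
    exact derivative_C
  have hG1 : coeff 1 G = 2 * X * constantCoeff (d⁄dX ℚ⟦X⟧ E) - (1 - X) + 2 * X * e := by
    have h1 : coeff 1 G = constantCoeff (d⁄dX ℚ⟦X⟧ G) := by
      rw [← coeff_zero_eq_constantCoeff_apply, coeff_derivative]
      simp
    have h2 : d⁄dX ℚ⟦X⟧ G = 2 * Z * d⁄dX ℚ⟦X⟧ E -
        ((1 - 2 * x) * (1 - Z) - 2 * Z * (1 - x) * C e) := by
      have h3 : d⁄dX ℚ⟦X⟧ (2 : ℚ⟦X⟧⟦X⟧) = 0 := by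
        rw [← one_add_one_eq_two, map_add, h4, add_zero]
      simp only [hG, map_sub, map_add, Derivation.leibniz, Derivation.leibniz_pow, hd0, hd1, hd2,
        h3, h4, smul_eq_mul, nsmul_eq_mul]
      push_cast
      ring
    rw [h1, h2]
    simp only [hZ, hx, map_sub, map_mul, map_one, map_ofNat, constantCoeff_C, constantCoeff_X]
    ring
  have hmem : constantCoeff G ∈ IsLocalRing.maximalIdeal ℚ⟦X⟧ := by
    rw [hG0, PowerSeries.maximalIdeal_eq_span_X]
    exact Ideal.mul_mem_right _ _ (Ideal.mem_span_singleton_self _)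
  have hunit : IsUnit (coeff 1 G) := by
    rw [PowerSeries.isUnit_iff_constantCoeff, hG1]
    simp
  obtain ⟨q₁, x₀, h1⟩ := exists_eq_mul_add_C hmem hunit x
  obtain ⟨q₂, ε, h2⟩ := exists_eq_mul_add_C hmem hunit E
  have hπG : Ideal.Quotient.mk (Ideal.span {G}) G = 0 :=
    Ideal.Quotient.eq_zero_iff_mem.2 (Ideal.mem_span_singleton_self _)
  have hπ : ∀ r : ℚ⟦X⟧, Ideal.Quotient.mk (Ideal.span {G}) (C r) = 0 → r = 0 := by
    intro r hr
    obtain ⟨q, hq⟩ := Ideal.mem_span_singleton'.1 (Ideal.Quotient.eq_zero_iff_mem.1 hr)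
    exact eq_zero_of_C_eq_mul hmem hunit (q := q) (by rw [← hq, mul_comm])
  have hπx : Ideal.Quotient.mk (Ideal.span {G}) x = Ideal.Quotient.mk (Ideal.span {G}) (C x₀) := by
    conv_lhs => rw [h1, map_add, map_mul, hπG, zero_mul, zero_add]
  have hπE : Ideal.Quotient.mk (Ideal.span {G}) E = Ideal.Quotient.mk (Ideal.span {G}) (C ε) := by
    conv_lhs => rw [h2, map_add, map_mul, hπG, zero_mul, zero_add]
  have hE' : G * d⁄dX ℚ⟦X⟧ E - ((1 - 2 * x) * (1 - Z) - 2 * Z * (1 - x) * C e) * E +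
      ((1 - 2 * x) - 2 * Z * (1 - x) * C e) = 0 := by
    have h := congrArg (d⁄dX ℚ⟦X⟧) hE
    simp only [map_sub, map_add, Derivation.leibniz, Derivation.leibniz_pow, hd0, hd1, hd2,
      h4, smul_eq_mul, nsmul_eq_mul, map_zero] at h
    push_cast at h
    rw [hG]
    linear_combination h
  refine ⟨x₀, ε, ?_, ?_, ?_, ?_, ?_⟩
  · have h := congrArg (fun f => constantCoeff (constantCoeff f)) h1
    simp only [hx, map_add, map_mul, hG0, constantCoeff_X, constantCoeff_C, zero_mul, zero_add,
      map_zero] at h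
    exact h.symm
  · have h := congrArg (fun f => constantCoeff (constantCoeff f)) h2
    simp only [map_add, map_mul, hG0, constantCoeff_X, constantCoeff_C, zero_mul, zero_add, he,
      he1] at h
    exact h.symm
  · apply hπ
    have h := congrArg (Ideal.Quotient.mk (Ideal.span {G})) hE
    simp only [map_sub, map_add, map_mul, map_pow, map_one, map_zero, hπx, hπE] at h ⊢
    exact h
  · apply hπ
    have h : Ideal.Quotient.mk (Ideal.span {G})
        (2 * Z * E - (x * (1 - x) * (1 - Z) + Z * (1 - x) ^ 2 * C e + Z)) = 0 := by
      rw [← hG, hπG]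
    simp only [map_sub, map_add, map_mul, map_pow, map_one, map_ofNat, hπx, hπE] at h ⊢
    exact h
  · rw [← sub_eq_zero]
    apply hπ
    have h := congrArg (Ideal.Quotient.mk (Ideal.span {G})) hE'
    simp only [map_sub, map_add, map_mul, map_one, map_ofNat, map_zero, hπx, hπE, hπG] at h ⊢
    linear_combination -h

/-- The quadratic equation for the excursions, with `x` marking the lost block boundaries. -/
theorem excursion_quadratic :
    ∃ E : ℚ⟦X⟧⟦X⟧, constantCoeff E = excursionSeries 0 ∧
    C (X : ℚ⟦X⟧) * E ^ 2 - (X * (1 - X) * (1 - C (X : ℚ⟦X⟧)) +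
      C (X : ℚ⟦X⟧) * (1 - X) ^ 2 * C (excursionSeries 0) + C (X : ℚ⟦X⟧)) * E +
      (X * (1 - X) + C (X : ℚ⟦X⟧) * (1 - X) ^ 2 * C (excursionSeries 0)) = 0 := by
  set Z : ℚ⟦X⟧⟦X⟧ := C (X : ℚ⟦X⟧) with hZ
  set x : ℚ⟦X⟧⟦X⟧ := X with hx
  set e : ℚ⟦X⟧⟦X⟧ := C (excursionSeries 0) with he
  let F : ℚ⟦X⟧⟦X⟧ := PowerSeries.mk excursionSeries
  let K : ℚ⟦X⟧⟦X⟧ := PowerSeries.mk closedSeries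
  let S : ℚ⟦X⟧⟦X⟧ := PowerSeries.mk fun m => excursionSeries (m + 1)
  have hF : (1 - x) * F = 1 + Z * (1 - x) * K := by
    have h1 : F = PowerSeries.mk 1 + Z * K := by
      ext m : 1
      simp [F, K, hZ, excursionSeries, coeff_C_mul]
    have h2 : (PowerSeries.mk 1 : ℚ⟦X⟧⟦X⟧) * (1 - x) = 1 := mk_one_mul_one_sub_eq_one _
    rw [h1]
    linear_combination h2
  have hS : x * S = F - e := by
    ext m : 1
    cases m with
    | zero => simp [F, S, hx, he]
    | succ m => simp [F, S, hx, he, coeff_succ_X_mul]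
  have hK : K = F + Z * (e * K + S * K) := by
    ext m : 1
    rw [map_add, hZ, coeff_C_mul, map_add, he, coeff_C_mul, coeff_mul]
    simp only [K, F, S, coeff_mk]
    exact closedSeries_eq m
  refine ⟨(1 - x) * F, by simp [F, hx], ?_⟩
  have h1 : x * K = x * F + Z * x * e * K + Z * (F - e) * K := by
    linear_combination x * hK + Z * K * hS
  linear_combination (-(Z * (1 - x) ^ 2)) * h1 -
    ((1 - x) * x - Z * (1 - x) * x * e - Z * (1 - x) * (F - e)) * hF

/-! ### The algebraic parametrization -/

/-- The generating function is a rational function of a series `s` with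
`s = z (1 + 2 s) (1 + s + s²)`. -/
theorem exists_parametrization : ∃ s : ℚ⟦X⟧, constantCoeff s = 0 ∧
    s = X * ((1 + 2 * s) * (1 + s + s ^ 2)) ∧
    (genFun312 - 1) * ((1 + s) * (1 + s ^ 2) ^ 2) = s := by
  obtain ⟨E, hE0, hE⟩ := excursion_quadratic
  set e := excursionSeries 0 with he
  have he1 : constantCoeff e = 1 := by simp [he, excursionSeries]
  obtain ⟨x₀, ε, hx0, hε0, h1, h2, h3⟩ := exists_critical_point e E hE0 he1 hE
  have hXne : (X : ℚ⟦X⟧) ≠ 0 := X_ne_zero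
  obtain ⟨w, rfl⟩ : ∃ w, x₀ = 1 - w := ⟨1 - x₀, by ring⟩
  have hw1 : constantCoeff w = 1 := by
    rw [map_sub, map_one, sub_eq_zero] at hx0
    exact hx0.symm
  have hww : w * w⁻¹ = 1 := PowerSeries.mul_inv_cancel w (by rw [hw1]; exact one_ne_zero)
  have hwne : w ≠ 0 := fun h => by simp [h] at hw1
  -- the conic `(ε - 1)² = w (1 - w)`, which is parametrized by `s = (ε - 1) / w`
  have hconic : (ε - 1) ^ 2 = w * (1 - w) := by
    apply mul_left_cancel₀ hXne
    linear_combination -h1 + (ε - 1) * h2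
  obtain ⟨s, hs⟩ : ∃ s, s * w = ε - 1 := ⟨(ε - 1) * w⁻¹, by rw [mul_assoc, mul_comm w⁻¹, hww,
    mul_one]⟩
  have hs0 : constantCoeff s = 0 := by
    have := congrArg constantCoeff hs
    simpa [hw1, hε0] using this
  have hws : w * (1 + s ^ 2) = 1 := by
    apply mul_left_cancel₀ hwne
    linear_combination hconic + (s * w + ε - 1) * hs
  have hε : (1 + s ^ 2) * ε = 1 + s + s ^ 2 := by
    linear_combination s * hws - (1 + s ^ 2) * hs
  have hc : w - w ^ 2 + X * w ^ 2 * e = X * ε ^ 2 := by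
    linear_combination h1 - ε * h2
  have hsw : s * w = X * ε * (1 + 2 * s) := by
    apply mul_left_cancel₀ hwne
    linear_combination w * h3 + 2 * (ε - 1) * hc + (w - 2 * X * ε ^ 2) * hs +
      w * X * ε * (2 * hws - 2 * s * hs)
  have hsz : s = X * ((1 + 2 * s) * (1 + s + s ^ 2)) := by
    linear_combination (-s) * hws + (1 + s ^ 2) * hsw + X * (1 + 2 * s) * hε
  refine ⟨s, hs0, hsz, ?_⟩
  set y := (1 - X - X * e)⁻¹ with hy
  have hy1 : y * (1 - X - X * e) = 1 := PowerSeries.inv_mul_cancel _ (by simp)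
  rw [genFun312_eq y hy1]
  have hf : (1 + 2 * s) * (1 - X * e) = 1 + s + s ^ 3 := by
    have h : 1 - X * e = (1 + s ^ 2) - X * (1 + s + s ^ 2) ^ 2 := by
      linear_combination (-(1 + s ^ 2) ^ 2) * hc + (1 + s ^ 2) * hws -
        (w * (1 + s ^ 2) + 1) * (1 - X * e) * hws -
        X * ((1 + s ^ 2) * ε + (1 + s + s ^ 2)) * hε
    linear_combination (1 + 2 * s) * h + (1 + s + s ^ 2) * hsz
  have hd : (1 + 2 * s) * (1 + s + s ^ 2) * (1 - X - X * e) = (1 + s) * (1 + s ^ 2) ^ 2 := by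
    linear_combination (1 + s + s ^ 2) * hf + hsz
  rw [← hd]
  linear_combination X * (1 + 2 * s) * (1 + s + s ^ 2) * hy1 - hsz

end Parametrization

section Lagrange

open Finset PowerSeries

/-! ### The cubic equation -/

theorem cubic_of_parametrization {K : Type*} [Field K] {s z B : K}
    (h1 : (1 + 2 * s) * (1 + s + s ^ 2) ≠ 0) (h2 : (1 + s) * (1 + s ^ 2) ^ 2 ≠ 0)
    (hz : s = z * ((1 + 2 * s) * (1 + s + s ^ 2)))
    (hB : (B - 1) * ((1 + s) * (1 + s ^ 2) ^ 2) = s) :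
    (z - 1) * (5 * z ^ 2 - 2 * z + 1) ^ 2 * B ^ 3 +
      (-9 * z ^ 5 + 54 * z ^ 4 - 85 * z ^ 3 + 59 * z ^ 2 - 14 * z + 3) * B ^ 2 +
      (-9 * z ^ 4 + 60 * z ^ 3 - 64 * z ^ 2 + 13 * z - 3) * B +
      (-9 * z ^ 3 + 23 * z ^ 2 - 4 * z + 1) = 0 := by
  set P := (1 + 2 * s) * (1 + s + s ^ 2) with hP
  set D := (1 + s) * (1 + s ^ 2) ^ 2 with hD
  have hB' : B * D = D + s := by linear_combination hB
  -- the homogenized cubic, at `(z P, P)` and `(B D, D)`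
  have key : ∀ z P B D : K, P ^ 5 * D ^ 3 * ((z - 1) * (5 * z ^ 2 - 2 * z + 1) ^ 2 * B ^ 3 +
      (-9 * z ^ 5 + 54 * z ^ 4 - 85 * z ^ 3 + 59 * z ^ 2 - 14 * z + 3) * B ^ 2 +
      (-9 * z ^ 4 + 60 * z ^ 3 - 64 * z ^ 2 + 13 * z - 3) * B +
      (-9 * z ^ 3 + 23 * z ^ 2 - 4 * z + 1)) =
      (z * P - P) * (5 * (z * P) ^ 2 - 2 * (z * P) * P + P ^ 2) ^ 2 * (B * D) ^ 3 +
      (-9 * (z * P) ^ 5 + 54 * (z * P) ^ 4 * P - 85 * (z * P) ^ 3 * P ^ 2 +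
        59 * (z * P) ^ 2 * P ^ 3 - 14 * (z * P) * P ^ 4 + 3 * P ^ 5) * (B * D) ^ 2 * D +
      (-9 * (z * P) ^ 4 * P + 60 * (z * P) ^ 3 * P ^ 2 - 64 * (z * P) ^ 2 * P ^ 3 +
        13 * (z * P) * P ^ 4 - 3 * P ^ 5) * (B * D) * D ^ 2 +
      (-9 * (z * P) ^ 3 * P ^ 2 + 23 * (z * P) ^ 2 * P ^ 3 - 4 * (z * P) * P ^ 4 + P ^ 5) *
        D ^ 3 := by
    intro z P B D
    ring
  refine (mul_eq_zero.1 ?_).resolve_left (mul_ne_zero (pow_ne_zero 5 h1) (pow_ne_zero 3 h2))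
  rw [key, ← hz, hB', hP, hD]
  ring

theorem aeval_cubic312 : Polynomial.aeval genFun312 cubic312 = 0 := by
  obtain ⟨s, hs0, hs, hB⟩ := exists_parametrization
  let φ := algebraMap ℚ⟦X⟧ (FractionRing ℚ⟦X⟧)
  have hφ : Function.Injective φ := IsFractionRing.injective _ _
  have hne : ∀ f : ℚ⟦X⟧, constantCoeff f = 1 → φ f ≠ 0 := by
    intro f hf h
    rw [map_eq_zero_iff φ hφ] at h
    simp [h] at hf
  have h1 := hne ((1 + 2 * s) * (1 + s + s ^ 2)) (by simp [hs0])
  have h2 := hne ((1 + s) * (1 + s ^ 2) ^ 2) (by simp [hs0])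
  have hs' := congrArg φ hs
  have hB' := congrArg φ hB
  simp only [map_mul, map_add, map_pow, map_one, map_ofNat, map_sub] at h1 h2 hs' hB'
  have h := cubic_of_parametrization h1 h2 hs' hB'
  have hX : algebraMap (Polynomial ℚ) ℚ⟦X⟧ Polynomial.X = X := by
    rw [PowerSeries.algebraMap_apply']
    simp
  apply hφ
  simp only [cubic312, map_add, map_mul, map_pow, map_sub, map_neg, map_one, map_ofNat, map_zero,
    Polynomial.aeval_C, Polynomial.aeval_X, hX]
  exact h

theorem isAlgebraic_genFun312 : IsAlgebraic (Polynomial ℚ) genFun312 := by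
  refine ⟨cubic312, ?_, aeval_cubic312⟩
  intro h
  have h' := congrArg (fun p => (p.eval 0).eval 0) h
  simp [cubic312] at h'

/-! ### Lagrange inversion -/

theorem coeff_pow_eq_zero {s : ℚ⟦X⟧} (hs : constantCoeff s = 0) {n k : ℕ} (h : n < k) :
    coeff n (s ^ k) = 0 := by
  obtain ⟨t, rfl⟩ := X_dvd_iff.2 hs
  rw [mul_pow, coeff_X_pow_mul', if_neg (by omega)]

theorem coeff_subst_eq_sum {s : ℚ⟦X⟧} (hs : constantCoeff s = 0) (H : ℚ⟦X⟧) (n : ℕ) :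
    coeff n (H.subst s) = ∑ k ∈ range (n + 1), coeff k H * coeff n (s ^ k) := by
  rw [coeff_subst' (HasSubst.of_constantCoeff_zero' hs)]
  refine finsum_eq_sum_of_support_subset _ fun k hk => ?_
  rw [Function.mem_support] at hk
  by_contra hk'
  refine hk ?_
  rw [coeff_pow_eq_zero hs (by simpa using hk'), smul_zero]

theorem coeff_X_mul_derivative (f : ℚ⟦X⟧) (n : ℕ) : coeff n (X * d⁄dX ℚ f) = n * coeff n f := by
  cases n with
  | zero => simp
  | succ n =>
    rw [coeff_succ_X_mul, coeff_derivative]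
    push_cast
    ring

/-- **Lagrange inversion**: if `s = z Φ(s)`, then `n [zⁿ] H(s) = [tⁿ⁻¹] H'(t) Φ(t)ⁿ`. -/
theorem lagrange_inversion {Φ s : ℚ⟦X⟧} (hs0 : constantCoeff s = 0) (hs : s = X * Φ.subst s)
    (n : ℕ) (H : ℚ⟦X⟧) : n * coeff n (H.subst s) = coeff n (X * d⁄dX ℚ H * Φ ^ n) := by
  have hsub : HasSubst s := HasSubst.of_constantCoeff_zero' hs0
  induction n using Nat.strong_induction_on generalizing H with
  | _ n ih =>
    -- it suffices to treat the powers of `s`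
    have key : ∀ k ≤ n, (n : ℚ) * coeff n (s ^ k) = k * coeff (n - k) (Φ ^ n) := by
      intro k hk
      rcases Nat.eq_zero_or_pos k with rfl | hk0
      · rcases Nat.eq_zero_or_pos n with rfl | hn
        · simp
        · simp [coeff_one, hn.ne']
      rcases hk.eq_or_lt with rfl | hlt
      · have h : coeff k (s ^ k) = constantCoeff (Φ ^ k) := by
          conv_lhs => rw [hs, mul_pow, ← subst_pow hsub, coeff_X_pow_mul', if_pos le_rfl,
            Nat.sub_self, coeff_subst_eq_sum hs0]
          simp
        rw [h, Nat.sub_self, coeff_zero_eq_constantCoeff_apply]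
      · have h1 : coeff n (s ^ k) = coeff (n - k) ((Φ ^ k).subst s) := by
          conv_lhs => rw [hs, mul_pow, ← subst_pow hsub, coeff_X_pow_mul', if_pos hk]
        have h2 := ih (n - k) (by omega) (Φ ^ k)
        have h3 : d⁄dX ℚ (Φ ^ k) * Φ ^ (n - k) * (n : ℚ⟦X⟧) = (k : ℚ⟦X⟧) * d⁄dX ℚ (Φ ^ n) := by
          simp only [Derivation.leibniz_pow, smul_eq_mul, nsmul_eq_mul]
          have : Φ ^ (k - 1) * Φ ^ (n - k) = Φ ^ (n - 1) := by
            rw [← pow_add]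
            congr 1
            omega
          linear_combination (k : ℚ⟦X⟧) * n * d⁄dX ℚ Φ * this
        have h4 : (n : ℚ) * coeff (n - k) (X * d⁄dX ℚ (Φ ^ k) * Φ ^ (n - k)) =
            k * coeff (n - k) (X * d⁄dX ℚ (Φ ^ n)) := by
          have h5 : X * d⁄dX ℚ (Φ ^ k) * Φ ^ (n - k) * (n : ℚ⟦X⟧) =
              (X * d⁄dX ℚ (Φ ^ n)) * (k : ℚ⟦X⟧) := by
            linear_combination X * h3
          have h6 := congrArg (coeff (n - k)) h5
          rw [← map_natCast (C (R := ℚ)) n, ← map_natCast (C (R := ℚ)) k, coeff_mul_C,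
            coeff_mul_C] at h6
          linear_combination h6
        rw [coeff_X_mul_derivative, ← h2, ← h1] at h4
        have hne : ((n - k : ℕ) : ℚ) ≠ 0 := Nat.cast_ne_zero.2 (by omega)
        apply mul_left_cancel₀ hne
        linear_combination h4
    rw [coeff_subst_eq_sum hs0, coeff_mul, Nat.sum_antidiagonal_eq_sum_range_succ_mk, mul_sum]
    refine sum_congr rfl fun k hk => ?_
    rw [coeff_X_mul_derivative, mul_left_comm, key k (by have := mem_range.1 hk; omega)]
    ring

/-! ### A coefficient formula -/

/-- The series `(1 + 2 t) (1 + t + t²)` whose powers govern the coefficients. -/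
def stepSeries : ℚ⟦X⟧ := (1 + 2 * X) * (1 + X + X ^ 2)

/-- The series `(2 - 4 t² - 6 t³) / ((1 + t)³ (1 + t²)⁴)`. -/
def weightSeries : ℚ⟦X⟧ :=
  (2 - 4 * X ^ 2 - 6 * X ^ 3) * ((1 + X)⁻¹ ^ 3 * (1 + X ^ 2)⁻¹ ^ 4)

theorem derivative_one : d⁄dX ℚ (1 : ℚ⟦X⟧) = 0 := by
  rw [← map_one (C (R := ℚ))]
  exact derivative_C

/-- Lagrange inversion gives the coefficients. In this case the derivative of the outer function has
the factor `Φ - t Φ'`, which vanishes at the saddle point; integrating by parts once more brings out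
the additional factor `m + 2`. -/
theorem numAvoiding_eq_coeff (m : ℕ) :
    ((m : ℚ) + 1) * (m + 2) * numAvoiding perm312 (m + 1) =
      coeff m (weightSeries * stepSeries ^ (m + 2)) := by
  obtain ⟨s, hs0, hs, hB⟩ := exists_parametrization
  have hsub : HasSubst s := HasSubst.of_constantCoeff_zero' hs0
  have hmap : ∀ f : ℚ⟦X⟧, f.subst s = substAlgHom (R := ℚ) hsub f := fun f => by
    rw [coe_substAlgHom]
  have hs' : s = X * stepSeries.subst s := by
    rw [hmap, stepSeries]
    simp only [map_mul, map_add, map_pow, map_one, map_ofNat, substAlgHom_X]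
    exact hs
  obtain ⟨p, hp⟩ : ∃ p : ℚ⟦X⟧, p = (1 + X)⁻¹ := ⟨_, rfl⟩
  obtain ⟨q, hq⟩ : ∃ q : ℚ⟦X⟧, q = (1 + X ^ 2)⁻¹ := ⟨_, rfl⟩
  have hp1 : (1 + X) * p = 1 := by
    rw [hp]
    exact PowerSeries.mul_inv_cancel _ (by simp)
  have hq1 : (1 + X ^ 2) * q = 1 := by
    rw [hq]
    exact PowerSeries.mul_inv_cancel _ (by simp)
  have hdX : d⁄dX ℚ (X : ℚ⟦X⟧) = 1 := derivative_X
  have hdp : d⁄dX ℚ p = -p ^ 2 := by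
    have h := congrArg (d⁄dX ℚ) hp1
    simp only [Derivation.leibniz, map_add, derivative_one, hdX, smul_eq_mul, zero_add,
      mul_one] at h
    linear_combination p * h - d⁄dX ℚ p * hp1
  have hdq : d⁄dX ℚ q = -2 * X * q ^ 2 := by
    have h := congrArg (d⁄dX ℚ) hq1
    simp only [Derivation.leibniz, Derivation.leibniz_pow, map_add, derivative_one, hdX,
      smul_eq_mul, nsmul_eq_mul, zero_add, mul_one] at h
    push_cast at h
    linear_combination q * h - d⁄dX ℚ q * hq1
  -- the outer function `H` and the factor `G` of its derivative
  set H : ℚ⟦X⟧ := X * (p * q ^ 2) with hH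
  set G : ℚ⟦X⟧ := p ^ 2 * q ^ 3 with hG
  have hHs : genFun312 = 1 + H.subst s := by
    have h1 : H * ((1 + X) * (1 + X ^ 2) ^ 2) = X := by
      rw [hH]
      linear_combination X * (1 + X ^ 2) ^ 2 * q ^ 2 * hp1 + X * ((1 + X ^ 2) * q + 1) * hq1
    have h2 := congrArg (substAlgHom (R := ℚ) hsub) h1
    simp only [map_mul, map_add, map_pow, map_one, substAlgHom_X] at h2
    have hne : (1 + s) * (1 + s ^ 2) ^ 2 ≠ 0 := by
      intro h
      have := congrArg constantCoeff h
      simp [hs0] at this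
    apply mul_right_cancel₀ hne
    rw [hmap]
    linear_combination hB - h2
  have hPd : stepSeries - X * d⁄dX ℚ stepSeries = 1 - 3 * X ^ 2 - 4 * X ^ 3 := by
    have h2 : d⁄dX ℚ (2 : ℚ⟦X⟧) = 0 := by
      rw [← one_add_one_eq_two, map_add, derivative_one, add_zero]
    simp only [stepSeries, Derivation.leibniz, Derivation.leibniz_pow, map_add, derivative_one, hdX,
      h2, smul_eq_mul, nsmul_eq_mul]
    push_cast
    ring
  have hHd : d⁄dX ℚ H = (stepSeries - X * d⁄dX ℚ stepSeries) * G := by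
    rw [hPd, hH, hG]
    simp only [Derivation.leibniz, Derivation.leibniz_pow, hdX, hdp, hdq, smul_eq_mul, nsmul_eq_mul]
    push_cast
    -- both sides have the common denominator `(1 + X)² (1 + X²)³`
    have e1 : p * q ^ 2 = p ^ 2 * q ^ 3 * ((1 + X) * (1 + X ^ 2)) := by
      linear_combination (-(p * q ^ 2)) * hq1 - p * q ^ 3 * (1 + X ^ 2) * hp1
    have e2 : p ^ 2 * q ^ 2 = p ^ 2 * q ^ 3 * (1 + X ^ 2) := by
      linear_combination (-(p ^ 2 * q ^ 2)) * hq1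
    have e3 : p * q ^ 3 = p ^ 2 * q ^ 3 * (1 + X) := by
      linear_combination (-(p * q ^ 3)) * hp1
    linear_combination e1 - X * e2 - 4 * X ^ 2 * e3
  have hM : weightSeries = 2 * G + X * d⁄dX ℚ G := by
    rw [weightSeries, ← hp, ← hq, hG]
    simp only [Derivation.leibniz, Derivation.leibniz_pow, hdp, hdq, smul_eq_mul, nsmul_eq_mul]
    push_cast
    have e1 : p ^ 2 * q ^ 3 = p ^ 3 * q ^ 4 * ((1 + X) * (1 + X ^ 2)) := by
      linear_combination (-(p ^ 2 * q ^ 3)) * hq1 - p ^ 2 * q ^ 4 * (1 + X ^ 2) * hp1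
    have e2 : p ^ 3 * q ^ 3 = p ^ 3 * q ^ 4 * (1 + X ^ 2) := by
      linear_combination (-(p ^ 3 * q ^ 3)) * hq1
    have e3 : p ^ 2 * q ^ 4 = p ^ 3 * q ^ 4 * (1 + X) := by
      linear_combination (-(p ^ 2 * q ^ 4)) * hp1
    linear_combination -2 * e1 + 2 * X * e2 + 6 * X ^ 2 * e3
  have hL := lagrange_inversion hs0 hs' (m + 1) H
  have hcoeff : coeff (m + 1) (H.subst s) = (numAvoiding perm312 (m + 1) : ℚ) := by
    have h := congrArg (coeff (m + 1)) hHs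
    rw [genFun312, coeff_mk, map_add, coeff_one, if_neg (by omega), zero_add] at h
    exact h.symm
  rw [hcoeff, hHd] at hL
  set Q := stepSeries ^ (m + 2) with hQ
  have hQd : d⁄dX ℚ Q = ((m + 2 : ℕ) : ℚ⟦X⟧) * (stepSeries ^ (m + 1) * d⁄dX ℚ stepSeries) := by
    rw [hQ, Derivation.leibniz_pow, smul_eq_mul, nsmul_eq_mul]
    rfl
  have hser : ((m + 2 : ℕ) : ℚ⟦X⟧) * (X * ((stepSeries - X * d⁄dX ℚ stepSeries) * G) *
      stepSeries ^ (m + 1)) =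
      X * (((m + 2 : ℕ) : ℚ⟦X⟧) * (G * Q) - X * d⁄dX ℚ (G * Q) + X * d⁄dX ℚ G * Q) := by
    rw [Derivation.leibniz, hQd, hQ, smul_eq_mul, smul_eq_mul, pow_succ stepSeries (m + 1)]
    ring
  have hfin := congrArg (coeff (m + 1)) hser
  rw [coeff_succ_X_mul, map_add, map_sub, coeff_X_mul_derivative, ← map_natCast (C (R := ℚ)),
    coeff_C_mul, coeff_C_mul, ← hL] at hfin
  have hsplit : weightSeries * Q = C (2 : ℚ) * (G * Q) + X * d⁄dX ℚ G * Q := by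
    rw [hM, map_ofNat]
    ring
  rw [hsplit, map_add (coeff m), coeff_C_mul]
  push_cast at hfin
  linear_combination hfin

end Lagrange

section LocalLimitTheorem

open Finset MeasureTheory Filter Topology
open scoped Real

/-! ### A local limit theorem for powers of a polynomial -/

section LocalLimit

theorem integral_exp_int_mul (m : ℤ) :
    ∫ θ in -π..π, Complex.exp (m * θ * Complex.I) = if m = 0 then 2 * (π : ℂ) else 0 := by
  split_ifs with h
  · subst h
    simp
    ring
  · have hc : (m : ℂ) * Complex.I ≠ 0 := mul_ne_zero (Int.cast_ne_zero.2 h) Complex.I_ne_zero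
    have h1 : ∀ θ : ℝ, Complex.exp (m * θ * Complex.I) = Complex.exp (m * Complex.I * θ) := by
      intro θ
      ring_nf
    simp only [h1]
    rw [integral_exp_mul_complex hc, div_eq_zero_iff]
    left
    rw [sub_eq_zero, Complex.exp_eq_exp_iff_exists_int]
    refine ⟨m, ?_⟩
    push_cast
    ring

theorem coeff_eq_integral (q : Polynomial ℝ) (k : ℕ) :
    2 * (π : ℂ) * (q.coeff k : ℂ) = ∫ θ in -π..π,
      Polynomial.aeval (Complex.exp (θ * Complex.I)) q * Complex.exp (-(k * (θ * Complex.I))) := by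
  have h1 : ∀ θ : ℝ, Polynomial.aeval (Complex.exp (θ * Complex.I)) q *
      Complex.exp (-(k * (θ * Complex.I))) = ∑ i ∈ range (max q.natDegree k + 1),
        (q.coeff i : ℂ) * Complex.exp (((i : ℤ) - (k : ℤ) : ℤ) * θ * Complex.I) := by
    intro θ
    rw [Polynomial.aeval_eq_sum_range' (Nat.lt_succ_of_le (le_max_left q.natDegree k)), sum_mul]
    refine sum_congr rfl fun i _ => ?_
    rw [← Complex.exp_nat_mul, Complex.real_smul, mul_assoc, ← Complex.exp_add]
    congr 2
    push_cast
    ring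
  simp only [h1]
  rw [intervalIntegral.integral_finsetSum fun i _ =>
    (Continuous.intervalIntegrable (by fun_prop) _ _)]
  simp only [intervalIntegral.integral_const_mul, integral_exp_int_mul]
  rw [sum_eq_single_of_mem k (mem_range.2 (Nat.lt_succ_of_le (le_max_right _ _))) fun i _ hi => ?_]
  · simp
    ring
  · rw [if_neg (sub_ne_zero.2 (by exact_mod_cast hi)), mul_zero]

variable (p : Polynomial ℝ)

/-- The substitution `θ = u / √N` in the integral for the coefficients of `p ^ N`. -/
theorem sqrt_mul_coeff_eq_integral {N : ℕ} (hN : 0 < N) (k : ℕ) :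
    2 * (π : ℂ) * (((√N : ℝ) : ℂ) * ((p ^ N).coeff k : ℂ)) =
      ∫ u, (Set.Ioc (-(π * √N)) (π * √N)).indicator (fun u : ℝ =>
        (Polynomial.aeval (Complex.exp ((u / √N : ℝ) * Complex.I)) p) ^ N *
          Complex.exp (-(k * ((u / √N : ℝ) * Complex.I)))) u := by
  have hs : 0 < √(N : ℝ) := Real.sqrt_pos.2 (Nat.cast_pos.2 hN)
  rw [integral_indicator measurableSet_Ioc,
    ← intervalIntegral.integral_of_le (by nlinarith [mul_pos Real.pi_pos hs]),
    intervalIntegral.integral_comp_div (fun θ : ℝ =>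
      (Polynomial.aeval (Complex.exp (θ * Complex.I)) p) ^ N *
          Complex.exp (-(k * (θ * Complex.I)))) hs.ne']
  rw [neg_div, mul_div_cancel_right₀ _ hs.ne', Complex.real_smul]
  simp only [← map_pow]
  rw [← coeff_eq_integral]
  ring

variable {p}

/-- The characteristic function of a distribution that charges two neighbouring integers decays
like a Gaussian. -/
theorem norm_aeval_exp_le {d : ℕ} (hd : p.natDegree < d + 2) (hnn : ∀ i, 0 ≤ p.coeff i)
    (h1 : ∑ i ∈ range (d + 2), p.coeff i = 1) (h0 : 0 < p.coeff 0) {θ : ℝ} (hθ : |θ| ≤ π) :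
    ‖Polynomial.aeval (Complex.exp (θ * Complex.I)) p‖ ≤
      Real.exp (-(p.coeff 0 * p.coeff 1 * (2 / π ^ 2) * θ ^ 2)) := by
  rw [Polynomial.aeval_eq_sum_range' hd]
  rw [sum_range_succ', sum_range_succ'] at h1 ⊢
  set S := p.coeff 0 + p.coeff 1 with hS
  have hSpos : 0 < S := add_pos_of_pos_of_nonneg h0 (hnn 1)
  have htail : ‖∑ i ∈ range d, p.coeff (i + 1 + 1) • Complex.exp (θ * Complex.I) ^ (i + 1 + 1)‖ ≤
      1 - S := by
    refine (norm_sum_le _ _).trans (le_of_eq ?_)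
    have : ∀ i ∈ range d, ‖p.coeff (i + 1 + 1) • Complex.exp (θ * Complex.I) ^ (i + 1 + 1)‖ =
        p.coeff (i + 1 + 1) := by
      intro i _
      rw [norm_smul, norm_pow, Complex.norm_exp_ofReal_mul_I, one_pow, mul_one, Real.norm_eq_abs,
        abs_of_nonneg (hnn _)]
    rw [sum_congr rfl this]
    simp only [zero_add] at h1
    linarith
  set D := p.coeff 0 * p.coeff 1 * (1 - Real.cos θ) with hD
  have hcos := Real.cos_le_one θ
  have hD0 : 0 ≤ D := mul_nonneg (mul_nonneg h0.le (hnn 1)) (by linarith)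
  have hDS : D ≤ S ^ 2 := by
    have := Real.neg_one_le_cos θ
    have h2 : D ≤ p.coeff 0 * p.coeff 1 * 2 := by
      refine mul_le_mul_of_nonneg_left (by linarith) (mul_nonneg h0.le (hnn 1))
    nlinarith [sq_nonneg (p.coeff 0 - p.coeff 1), sq_nonneg (p.coeff 0 + p.coeff 1)]
  have hhead : ‖p.coeff (0 + 1) • Complex.exp (θ * Complex.I) ^ (0 + 1) +
      p.coeff 0 • Complex.exp (θ * Complex.I) ^ 0‖ ≤ S - D / S := by
    have hnonneg : 0 ≤ S - D / S := by
      rw [sub_nonneg, div_le_iff₀ hSpos]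
      nlinarith
    refine abs_le_of_sq_le_sq' ?_ hnonneg |>.2
    have hsq : ‖p.coeff (0 + 1) • Complex.exp (θ * Complex.I) ^ (0 + 1) +
        p.coeff 0 • Complex.exp (θ * Complex.I) ^ 0‖ ^ 2 = S ^ 2 - 2 * D := by
      rw [zero_add, pow_one, pow_zero, ← Complex.normSq_eq_norm_sq, Complex.normSq_apply,
        Complex.exp_mul_I, ← Complex.ofReal_cos, ← Complex.ofReal_sin]
      simp only [Complex.add_re, Complex.add_im, Complex.real_smul, Complex.mul_re, Complex.mul_im,
        Complex.ofReal_re, Complex.ofReal_im, Complex.I_re, Complex.I_im, Complex.one_re,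
        Complex.one_im]
      rw [hS, hD]
      linear_combination p.coeff 1 ^ 2 * Real.sin_sq_add_cos_sq θ
    rw [hsq]
    have : (S - D / S) ^ 2 = S ^ 2 - 2 * D + (D / S) ^ 2 := by
      field_simp
      ring
    rw [this]
    nlinarith [sq_nonneg (D / S)]
  have hS1 : S ≤ 1 := by
    have : 0 ≤ ∑ i ∈ range d, p.coeff (i + 1 + 1) := sum_nonneg fun i _ => hnn _
    simp only [zero_add] at h1
    linarith
  have hDle : D ≤ D / S := le_div_self hD0 hSpos hS1
  have hquad := Real.cos_le_one_sub_mul_cos_sq hθ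
  have hDθ : p.coeff 0 * p.coeff 1 * (2 / π ^ 2) * θ ^ 2 ≤ D := by
    rw [hD, mul_assoc]
    exact mul_le_mul_of_nonneg_left (by linarith) (mul_nonneg h0.le (hnn 1))
  have hexp := Real.add_one_le_exp (-(p.coeff 0 * p.coeff 1 * (2 / π ^ 2) * θ ^ 2))
  rw [add_assoc]
  refine (norm_add_le _ _).trans ?_
  linarith

/-- The rescaled integrand is dominated by a fixed Gaussian. -/
theorem norm_integrand_le {d : ℕ} (hd : p.natDegree < d + 2) (hnn : ∀ i, 0 ≤ p.coeff i)
    (h1 : ∑ i ∈ range (d + 2), p.coeff i = 1) (h0 : 0 < p.coeff 0) {N : ℕ} (hN : 0 < N) (k : ℕ)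
    (u : ℝ) : ‖(Set.Ioc (-(π * √N)) (π * √N)).indicator (fun u : ℝ =>
        (Polynomial.aeval (Complex.exp ((u / √N : ℝ) * Complex.I)) p) ^ N *
          Complex.exp (-(k * ((u / √N : ℝ) * Complex.I)))) u‖ ≤
      Real.exp (-(p.coeff 0 * p.coeff 1 * (2 / π ^ 2)) * u ^ 2) := by
  have hN' : (0 : ℝ) < N := Nat.cast_pos.2 hN
  have hs : 0 < √(N : ℝ) := Real.sqrt_pos.2 hN'
  by_cases hu : u ∈ Set.Ioc (-(π * √N)) (π * √N)
  · rw [Set.indicator_of_mem hu, norm_mul, norm_pow]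
    have hexp : ‖Complex.exp (-(k * ((u / √N : ℝ) * Complex.I)))‖ = 1 := by
      rw [show -((k : ℂ) * ((u / √N : ℝ) * Complex.I)) = ((-(k * (u / √N)) : ℝ) : ℂ) * Complex.I by
        push_cast; ring]
      exact Complex.norm_exp_ofReal_mul_I _
    rw [hexp, mul_one]
    have hθ : |u / √N| ≤ π := by
      rw [abs_div, abs_of_pos hs, div_le_iff₀ hs, abs_le]
      exact ⟨hu.1.le, hu.2⟩
    refine (pow_le_pow_left₀ (norm_nonneg _) (norm_aeval_exp_le hd hnn h1 h0 hθ) N).trans ?_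
    rw [← Real.exp_nat_mul, div_pow, Real.sq_sqrt hN'.le]
    refine le_of_eq (congrArg Real.exp ?_)
    field_simp
  · rw [Set.indicator_of_notMem hu, norm_zero]
    exact (Real.exp_pos _).le

/-- The coefficients of `p ^ N` are uniformly `O(1 / √N)`. -/
theorem exists_sqrt_mul_coeff_le {d : ℕ} (hd : p.natDegree < d + 2) (hnn : ∀ i, 0 ≤ p.coeff i)
    (h1 : ∑ i ∈ range (d + 2), p.coeff i = 1) (h0 : 0 < p.coeff 0) (h01 : 0 < p.coeff 1) :
    ∃ K : ℝ, ∀ N k : ℕ, ‖√(N : ℝ) * (p ^ N).coeff k‖ ≤ K := by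
  set c := p.coeff 0 * p.coeff 1 * (2 / π ^ 2) with hc
  have hcpos : 0 < c := by positivity
  have hint : Integrable fun u : ℝ => Real.exp (-c * u ^ 2) := integrable_exp_neg_mul_sq hcpos
  refine ⟨∫ u : ℝ, Real.exp (-c * u ^ 2), fun N k => ?_⟩
  rcases Nat.eq_zero_or_pos N with rfl | hN
  · simpa using integral_nonneg fun u => (Real.exp_pos _).le
  have h := congrArg norm (sqrt_mul_coeff_eq_integral p hN k)
  have hle := norm_integral_le_of_norm_le hint
    (ae_of_all _ (norm_integrand_le hd hnn h1 h0 hN k))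
  rw [← h, ← Complex.ofReal_mul, norm_mul, Complex.norm_real] at hle
  have h2π : (1 : ℝ) ≤ ‖2 * (π : ℂ)‖ := by
    rw [norm_mul, Complex.norm_real, Real.norm_eq_abs, abs_of_pos Real.pi_pos, Complex.norm_ofNat]
    linarith [Real.pi_gt_three]
  exact (le_mul_of_one_le_left (norm_nonneg _) h2π).trans hle

theorem tendsto_mul_exp_sub (b : ℝ) :
    Tendsto (fun N : ℕ => (N : ℂ) * (Complex.exp ((b / √N : ℝ) * Complex.I) - 1 -
      (b / √N : ℝ) * Complex.I)) atTop (𝓝 (-(b ^ 2 / 2 : ℝ))) := by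
  have hsqrt : Tendsto (fun N : ℕ => √(N : ℝ)) atTop atTop :=
    Real.tendsto_sqrt_atTop.comp tendsto_natCast_atTop_atTop
  have hb : Tendsto (fun N : ℕ => |b| / √(N : ℝ)) atTop (𝓝 0) := hsqrt.const_div_atTop _
  rw [tendsto_iff_norm_sub_tendsto_zero]
  have hlim : Tendsto (fun N : ℕ => |b| ^ 3 / √(N : ℝ)) atTop (𝓝 0) := hsqrt.const_div_atTop _
  refine squeeze_zero' (Eventually.of_forall fun _ => norm_nonneg _) ?_ hlim
  filter_upwards [hb.eventually (ge_mem_nhds zero_lt_one), eventually_gt_atTop 0] with N hN hN0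
  have hN' : (0 : ℝ) < N := Nat.cast_pos.2 hN0
  have hs : 0 < √(N : ℝ) := Real.sqrt_pos.2 hN'
  set z : ℂ := (b / √N : ℝ) * Complex.I with hz
  have hnz : ‖z‖ = |b| / √N := by
    rw [hz, norm_mul, Complex.norm_I, mul_one, Complex.norm_real, Real.norm_eq_abs, abs_div,
      abs_of_pos hs]
  have hbound := Complex.exp_bound (x := z) (by rw [hnz]; exact hN) (n := 3) (by norm_num)
  have hz2 : (N : ℂ) * (z ^ 2 / 2) = -(b ^ 2 / 2 : ℝ) := by
    rw [hz, mul_pow, Complex.I_sq, ← Complex.ofReal_pow, div_pow, Real.sq_sqrt hN'.le]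
    have : (N : ℂ) ≠ 0 := Nat.cast_ne_zero.2 hN0.ne'
    push_cast
    field_simp
  have hsum : ∑ m ∈ range 3, z ^ m / (m.factorial : ℂ) = 1 + z + z ^ 2 / 2 := by
    simp [sum_range_succ, Nat.factorial]
  rw [hsum] at hbound
  have heq : (N : ℂ) * (Complex.exp z - 1 - z) - -(b ^ 2 / 2 : ℝ) =
      N * (Complex.exp z - (1 + z + z ^ 2 / 2)) := by
    rw [← hz2]
    ring
  rw [heq, norm_mul, Complex.norm_natCast]
  have h3 : ‖Complex.exp z - (1 + z + z ^ 2 / 2)‖ ≤ (|b| / √N) ^ 3 := by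
    refine hbound.trans ?_
    rw [hnz]
    refine mul_le_of_le_one_right (by positivity) ?_
    norm_num [Nat.factorial]
  calc (N : ℝ) * ‖Complex.exp z - (1 + z + z ^ 2 / 2)‖ ≤ N * (|b| / √N) ^ 3 := by gcongr
    _ = |b| ^ 3 / √N := by
      rw [div_pow, pow_succ (√(N : ℝ)) 2, Real.sq_sqrt hN'.le]
      field_simp

/-- Local limit theorem for a distribution on the natural numbers with finite support and mean
one. -/
theorem tendsto_sqrt_mul_coeff {d : ℕ} (hd : p.natDegree < d + 2) (hnn : ∀ i, 0 ≤ p.coeff i)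
    (h1 : ∑ i ∈ range (d + 2), p.coeff i = 1) (h0 : 0 < p.coeff 0) (h01 : 0 < p.coeff 1)
    (hmean : ∑ i ∈ range (d + 2), p.coeff i * ((i : ℝ) - 1) = 0) {v : ℝ}
    (hv : ∑ i ∈ range (d + 2), p.coeff i * ((i : ℝ) - 1) ^ 2 = v) (l : ℕ) :
    Tendsto (fun N : ℕ => √(N : ℝ) * (p ^ N).coeff (N - l)) atTop (𝓝 (1 / √(2 * π * v))) := by
  have hvpos : 0 < v := by
    rw [← hv, sum_range_succ']
    have : 0 ≤ ∑ i ∈ range (d + 1), p.coeff (i + 1) * (((i + 1 : ℕ) : ℝ) - 1) ^ 2 :=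
      sum_nonneg fun i _ => mul_nonneg (hnn _) (sq_nonneg _)
    simp only [Nat.cast_zero, zero_sub, even_two, Even.neg_pow, one_pow, mul_one]
    linarith
  set c := p.coeff 0 * p.coeff 1 * (2 / π ^ 2) with hc
  have hcpos : 0 < c := by positivity
  have hsqrt : Tendsto (fun N : ℕ => √(N : ℝ)) atTop atTop :=
    Real.tendsto_sqrt_atTop.comp tendsto_natCast_atTop_atTop
  -- pointwise convergence of the rescaled characteristic function, centred at the mean
  have hpt : ∀ u : ℝ, Tendsto (fun N : ℕ =>
      (Polynomial.aeval (Complex.exp ((u / √N : ℝ) * Complex.I)) p *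
        Complex.exp (-((u / √N : ℝ) * Complex.I))) ^ N) atTop
      (𝓝 (Complex.exp (-(v * u ^ 2 / 2 : ℝ)))) := by
    intro u
    have hsum : ∀ N : ℕ, Polynomial.aeval (Complex.exp ((u / √N : ℝ) * Complex.I)) p *
        Complex.exp (-((u / √N : ℝ) * Complex.I)) = 1 + ∑ i ∈ range (d + 2), (p.coeff i : ℂ) *
          (Complex.exp (((((i : ℝ) - 1) * u) / √N : ℝ) * Complex.I) - 1 -
            ((((i : ℝ) - 1) * u) / √N : ℝ) * Complex.I) := by
      intro N
      have e1 : ∑ i ∈ range (d + 2), (p.coeff i : ℂ) = 1 := by exact_mod_cast h1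
      have e2 : ∑ i ∈ range (d + 2), (p.coeff i : ℂ) * ((i : ℂ) - 1) = 0 := by
        exact_mod_cast hmean
      have e3 : ∑ i ∈ range (d + 2), (p.coeff i : ℂ) *
          (((((i : ℝ) - 1) * u) / √N : ℝ) * Complex.I) = 0 := by
        rw [← zero_mul ((u / √N : ℝ) * Complex.I), ← e2, sum_mul]
        refine sum_congr rfl fun i _ => ?_
        push_cast
        ring
      simp only [mul_sub, sum_sub_distrib, mul_one, e1, e3, sub_zero]
      rw [Polynomial.aeval_eq_sum_range' hd, sum_mul, add_sub_cancel]
      refine sum_congr rfl fun i _ => ?_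
      rw [← Complex.exp_nat_mul, Complex.real_smul, mul_assoc, ← Complex.exp_add]
      congr 2
      push_cast
      ring
    simp only [hsum]
    refine Complex.tendsto_one_add_pow_exp_of_tendsto ?_
    have hlim : Tendsto (fun N : ℕ => ∑ i ∈ range (d + 2), (p.coeff i : ℂ) * ((N : ℂ) *
        (Complex.exp (((((i : ℝ) - 1) * u) / √N : ℝ) * Complex.I) - 1 -
            ((((i : ℝ) - 1) * u) / √N : ℝ) * Complex.I))) atTop
        (𝓝 (∑ i ∈ range (d + 2), (p.coeff i : ℂ) * (-((((i : ℝ) - 1) * u) ^ 2 / 2 : ℝ)))) :=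
      tendsto_finsetSum _ fun i _ => (tendsto_mul_exp_sub _).const_mul _
    have hval : ∑ i ∈ range (d + 2), (p.coeff i : ℂ) * (-((((i : ℝ) - 1) * u) ^ 2 / 2 : ℝ)) =
        (-(v * u ^ 2 / 2 : ℝ) : ℂ) := by
      rw [← hv]
      push_cast
      rw [sum_mul, sum_div, ← sum_neg_distrib]
      refine sum_congr rfl fun i _ => ?_
      ring
    rw [hval] at hlim
    refine hlim.congr fun N => ?_
    rw [mul_sum]
    exact sum_congr rfl fun i _ => by ring
  have hdom : Tendsto (fun N : ℕ => ∫ u, (Set.Ioc (-(π * √N)) (π * √N)).indicator (fun u : ℝ =>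
        (Polynomial.aeval (Complex.exp ((u / √N : ℝ) * Complex.I)) p) ^ N *
          Complex.exp (-((N - l : ℕ) * ((u / √N : ℝ) * Complex.I)))) u) atTop
      (𝓝 (∫ u : ℝ, Complex.exp (-(v * u ^ 2 / 2 : ℝ)))) := by
    refine tendsto_integral_filter_of_dominated_convergence (fun u => Real.exp (-c * u ^ 2)) ?_ ?_
      (integrable_exp_neg_mul_sq hcpos) ?_
    · refine Eventually.of_forall fun N => ?_
      refine (Continuous.aestronglyMeasurable ?_).indicator measurableSet_Ioc
      have : Continuous fun u : ℝ =>
          Polynomial.aeval (Complex.exp ((u / √N : ℝ) * Complex.I)) p :=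
        (Polynomial.continuous_aeval p).comp (by fun_prop)
      fun_prop
    · filter_upwards [eventually_gt_atTop 0] with N hN
      exact ae_of_all _ (norm_integrand_le hd hnn h1 h0 hN _)
    · refine ae_of_all _ fun u => ?_
      have hfac : Tendsto (fun N : ℕ => Complex.exp (l * ((u / √N : ℝ) * Complex.I))) atTop
          (𝓝 1) := by
        have h2 : Tendsto (fun N : ℕ => u / √(N : ℝ)) atTop (𝓝 0) := hsqrt.const_div_atTop _
        have h3 : Continuous fun x : ℝ => Complex.exp (l * ((x : ℂ) * Complex.I)) := by fun_prop
        have := (h3.tendsto 0).comp h2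
        simpa [Function.comp_def] using this
      have hlim := (hpt u).mul hfac
      rw [mul_one] at hlim
      refine hlim.congr' ?_
      have hbig : Tendsto (fun N : ℕ => π * √(N : ℝ)) atTop atTop :=
        hsqrt.const_mul_atTop Real.pi_pos
      filter_upwards [hbig.eventually_gt_atTop |u|, eventually_ge_atTop l] with N hN hl
      have hu := abs_lt.1 hN
      rw [Set.indicator_of_mem (show u ∈ Set.Ioc (-(π * √N)) (π * √N) from ⟨hu.1, hu.2.le⟩),
        mul_pow, mul_assoc, ← Complex.exp_nat_mul, ← Complex.exp_add, Nat.cast_sub hl]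
      congr 2
      ring
  have hgauss : ∫ u : ℝ, Complex.exp (-(v * u ^ 2 / 2 : ℝ)) = ((√(π / (v / 2)) : ℝ) : ℂ) := by
    rw [← integral_gaussian (v / 2), ← integral_complex_ofReal]
    refine integral_congr_ae (ae_of_all _ fun u => ?_)
    simp only
    push_cast
    ring_nf
  rw [hgauss] at hdom
  have hreal : Tendsto (fun N : ℕ => 2 * π * (√(N : ℝ) * (p ^ N).coeff (N - l))) atTop
      (𝓝 (√(π / (v / 2)))) := by
    have h2 := (Complex.continuous_re.tendsto _).comp hdom
    rw [Complex.ofReal_re] at h2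
    refine h2.congr' ?_
    filter_upwards [eventually_gt_atTop 0] with N hN
    rw [Function.comp_apply, ← sqrt_mul_coeff_eq_integral p hN]
    norm_cast
  have hfin := hreal.const_mul (1 / (2 * π))
  have hconst : 1 / (2 * π) * √(π / (v / 2)) = 1 / √(2 * π * v) := by
    have h2 : √(π / (v / 2)) = 2 * π / √(2 * π * v) := by
      rw [eq_div_iff (by positivity), ← Real.sqrt_mul (by positivity), show
        π / (v / 2) * (2 * π * v) = (2 * π) ^ 2 by field_simp]
      exact Real.sqrt_sq (by positivity)
    rw [h2]
    field_simp
  rw [hconst] at hfin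
  refine hfin.congr fun N => ?_
  have := Real.pi_ne_zero
  field_simp

end LocalLimit

end LocalLimitTheorem

section SaddlePoint

open Finset Filter Topology
open scoped Real

/-! ### Values of absolutely convergent power series -/

/-- The power series `f` converges absolutely at `x`, with value `v`. -/
structure HasAbsValue (x : ℝ) (f : PowerSeries ℚ) (v : ℝ) : Prop where
  summable : Summable fun j => ‖((PowerSeries.coeff j f : ℚ) : ℝ) * x ^ j‖
  tsum_eq : ∑' j, ((PowerSeries.coeff j f : ℚ) : ℝ) * x ^ j = v

namespace HasAbsValue

variable {x v w : ℝ} {f g : PowerSeries ℚ}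

theorem mul (hf : HasAbsValue x f v) (hg : HasAbsValue x g w) : HasAbsValue x (f * g) (v * w) := by
  have h : ∀ n, ((PowerSeries.coeff n (f * g) : ℚ) : ℝ) * x ^ n =
      ∑ kl ∈ antidiagonal n, (((PowerSeries.coeff kl.1 f : ℚ) : ℝ) * x ^ kl.1) *
        (((PowerSeries.coeff kl.2 g : ℚ) : ℝ) * x ^ kl.2) := by
    intro n
    rw [PowerSeries.coeff_mul]
    push_cast
    rw [sum_mul]
    refine sum_congr rfl fun kl hkl => ?_
    rw [← mem_antidiagonal.1 hkl, pow_add]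
    ring
  obtain ⟨F, hF⟩ : ∃ F : ℕ → ℝ, ∀ j, F j = ((PowerSeries.coeff j f : ℚ) : ℝ) * x ^ j :=
    ⟨_, fun _ => rfl⟩
  obtain ⟨G, hG⟩ : ∃ G : ℕ → ℝ, ∀ j, G j = ((PowerSeries.coeff j g : ℚ) : ℝ) * x ^ j :=
    ⟨_, fun _ => rfl⟩
  have hfs := hf.summable
  have hgs := hg.summable
  have hft := hf.tsum_eq
  have hgt := hg.tsum_eq
  simp only [← hF, ← hG] at h hfs hgs hft hgt
  constructor
  · simp only [h]
    exact summable_norm_sum_mul_antidiagonal_of_summable_norm hfs hgs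
  · simp only [h]
    rw [← tsum_mul_tsum_eq_tsum_sum_antidiagonal_of_summable_norm hfs hgs, hft, hgt]

theorem add (hf : HasAbsValue x f v) (hg : HasAbsValue x g w) : HasAbsValue x (f + g) (v + w) := by
  constructor
  · refine (hf.summable.add hg.summable).of_nonneg_of_le (fun _ => norm_nonneg _) fun j => ?_
    rw [map_add]
    push_cast
    rw [add_mul]
    exact norm_add_le _ _
  · rw [← hf.tsum_eq, ← hg.tsum_eq, ← hf.summable.of_norm.tsum_add hg.summable.of_norm]
    refine tsum_congr fun j => ?_
    rw [map_add]
    push_cast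
    ring

theorem monomial (x : ℝ) (k : ℕ) (q : ℚ) :
    HasAbsValue x (PowerSeries.C q * PowerSeries.X ^ k) (q * x ^ k) := by
  have h : ∀ j, ((PowerSeries.coeff j (PowerSeries.C q * PowerSeries.X ^ k) : ℚ) : ℝ) * x ^ j =
      if j = k then q * x ^ k else 0 := by
    intro j
    rw [PowerSeries.coeff_C_mul, PowerSeries.coeff_X_pow]
    split_ifs with hj
    · subst hj
      simp
    · simp
  constructor
  · simp only [h]
    exact summable_of_ne_finset_zero (s := {k}) fun j hj => by simp_all
  · simp only [h]
    exact tsum_ite_eq k _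

theorem pow (hf : HasAbsValue x f v) (n : ℕ) : HasAbsValue x (f ^ n) (v ^ n) := by
  induction n with
  | zero => simpa using monomial x 0 1
  | succ n ih =>
    rw [pow_succ, pow_succ]
    exact ih.mul hf

theorem inv_one_add_X_pow (hx0 : 0 ≤ x) (hx1 : x < 1) {k : ℕ} (hk : 0 < k) :
    HasAbsValue x (1 + PowerSeries.X ^ k)⁻¹ (1 + x ^ k)⁻¹ := by
  set f : PowerSeries ℚ := (1 + PowerSeries.X ^ k)⁻¹ with hf
  have hmul : (1 + PowerSeries.X ^ k) * f = 1 := by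
    rw [hf]
    exact PowerSeries.mul_inv_cancel _ (by simp [hk.ne'])
  have hbound : ∀ j, |PowerSeries.coeff j f| ≤ 1 := by
    intro j
    induction j using Nat.strong_induction_on with
    | _ j ih =>
      have h := congrArg (PowerSeries.coeff j) hmul
      rw [add_mul, one_mul, map_add, PowerSeries.coeff_X_pow_mul', PowerSeries.coeff_one] at h
      rcases Nat.eq_zero_or_pos j with rfl | hj
      · rw [if_neg (by omega), if_pos rfl, add_zero] at h
        rw [h, abs_one]
      · rw [if_neg hj.ne'] at h
        split_ifs at h with hkj
        · rw [eq_neg_of_add_eq_zero_left h, abs_neg]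
          exact ih (j - k) (by omega)
        · rw [add_zero] at h
          rw [h, abs_zero]
          exact zero_le_one
  have hsum : Summable fun j => ‖((PowerSeries.coeff j f : ℚ) : ℝ) * x ^ j‖ := by
    refine (summable_geometric_of_lt_one hx0 hx1).of_nonneg_of_le (fun _ => norm_nonneg _) ?_
    intro j
    rw [norm_mul, norm_pow, Real.norm_eq_abs, Real.norm_eq_abs, abs_of_nonneg hx0]
    refine mul_le_of_le_one_left (pow_nonneg hx0 j) ?_
    exact_mod_cast hbound j
  have hval : HasAbsValue x f (∑' j, ((PowerSeries.coeff j f : ℚ) : ℝ) * x ^ j) := ⟨hsum, rfl⟩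
  have h1 : HasAbsValue x (1 + PowerSeries.X ^ k) (1 + x ^ k) := by
    simpa using (monomial x 0 1).add (monomial x k 1)
  have h2 := (h1.mul hval).tsum_eq
  rw [hmul] at h2
  have h3 : HasAbsValue x 1 1 := by simpa using monomial x 0 1
  rw [h3.tsum_eq] at h2
  rw [← eq_inv_of_mul_eq_one_right h2.symm]
  exact hval

end HasAbsValue

theorem hasAbsValue_weightSeries {x : ℝ} (hx0 : 0 ≤ x) (hx1 : x < 1) :
    HasAbsValue x weightSeries
      ((2 - 4 * x ^ 2 - 6 * x ^ 3) * ((1 + x)⁻¹ ^ 3 * (1 + x ^ 2)⁻¹ ^ 4)) := by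
  have h1 := HasAbsValue.inv_one_add_X_pow hx0 hx1 (k := 1) one_pos
  have h2 := HasAbsValue.inv_one_add_X_pow hx0 hx1 (k := 2) two_pos
  rw [pow_one, pow_one] at h1
  have h3 : HasAbsValue x (2 - 4 * PowerSeries.X ^ 2 - 6 * PowerSeries.X ^ 3)
      (2 - 4 * x ^ 2 - 6 * x ^ 3) := by
    have h := ((HasAbsValue.monomial x 0 2).add (HasAbsValue.monomial x 2 (-4))).add
      (HasAbsValue.monomial x 3 (-6))
    convert h using 1
    · simp only [map_neg, map_ofNat]
      ring
    · push_cast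
      ring
  exact h3.mul ((h1.pow 3).mul (h2.pow 4))

/-! ### The saddle point -/

/-- The saddle point: the positive zero of `Φ(t) - t Φ'(t) = 1 - 3 t² - 4 t³`. -/
theorem exists_saddlePoint :
    ∃ r : ℝ, 0.4554100411 < r ∧ r < 0.4554100412 ∧ 4 * r ^ 3 + 3 * r ^ 2 = 1 := by
  have hcont : ContinuousOn (fun r : ℝ => 4 * r ^ 3 + 3 * r ^ 2)
      (Set.Icc 0.4554100411 0.4554100412) := by fun_prop
  have h := intermediate_value_Ioo (by norm_num) hcont
  obtain ⟨r, hr, h1⟩ := h (show (1 : ℝ) ∈ _ by constructor <;> norm_num)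
  exact ⟨r, hr.1, hr.2, h1⟩

section Saddle

variable {r : ℝ}

/-- The distribution with weights proportional to the coefficients of `Φ(r t)`. The normalization is
by `3 (1 + r)² / 2`, which is the value of `Φ(r)` at the saddle point. -/
def stepDistribution (r : ℝ) : Polynomial ℝ :=
  Cubic.toPoly ⟨4 * r ^ 3 / (3 * (1 + r) ^ 2), 2 * r ^ 2 / (1 + r) ^ 2, 2 * r / (1 + r) ^ 2,
    2 / (3 * (1 + r) ^ 2)⟩

theorem natDegree_stepDistribution : (stepDistribution r).natDegree < 2 + 2 :=
  Nat.lt_succ_of_le (Polynomial.natDegree_le_iff_coeff_eq_zero.2 fun _ hn =>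
    Cubic.coeff_eq_zero hn)

theorem coeff_stepDistribution_pow (hr : 0 < r) (N k : ℕ) :
    ((PowerSeries.coeff k (stepSeries ^ N) : ℚ) : ℝ) * r ^ k =
      (3 * (1 + r) ^ 2 / 2) ^ N * ((stepDistribution r) ^ N).coeff k := by
  have h1 : stepSeries = ((((1 + 2 * Polynomial.X) * (1 + Polynomial.X + Polynomial.X ^ 2) :
      Polynomial ℚ)) : PowerSeries ℚ) := by
    simp [stepSeries, Polynomial.coe_mul, Polynomial.coe_add]
    exact Or.inl (map_ofNat (Polynomial.coeToPowerSeries.ringHom (R := ℚ)) 2).symm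
  have hF : 3 * (1 + r) ^ 2 / 2 ≠ 0 := by positivity
  set P : Polynomial ℝ := (1 + 2 * Polynomial.X) * (1 + Polynomial.X + Polynomial.X ^ 2) with hP
  have h2 : ((PowerSeries.coeff k (stepSeries ^ N) : ℚ) : ℝ) = (P ^ N).coeff k := by
    have hmap : P = Polynomial.map (algebraMap ℚ ℝ)
        ((1 + 2 * Polynomial.X) * (1 + Polynomial.X + Polynomial.X ^ 2)) := by
      simp [hP]
    rw [h1, ← Polynomial.coe_pow, Polynomial.coeff_coe, hmap, ← Polynomial.map_pow,
      Polynomial.coeff_map]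
    rfl
  have h3 : Polynomial.C (3 * (1 + r) ^ 2 / 2) * stepDistribution r =
      P.comp (Polynomial.C r * Polynomial.X) := by
    have e1 : 3 * (1 + r) ^ 2 / 2 * (4 * r ^ 3 / (3 * (1 + r) ^ 2)) = 2 * r ^ 3 := by
      field_simp; norm_num
    have e2 : 3 * (1 + r) ^ 2 / 2 * (2 * r ^ 2 / (1 + r) ^ 2) = 3 * r ^ 2 := by
      field_simp
    have e3 : 3 * (1 + r) ^ 2 / 2 * (2 * r / (1 + r) ^ 2) = 3 * r := by
      field_simp
    have e4 : 3 * (1 + r) ^ 2 / 2 * (2 / (3 * (1 + r) ^ 2)) = 1 := by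
      field_simp
    rw [stepDistribution, Cubic.toPoly]
    simp only [mul_add, ← mul_assoc, ← Polynomial.C_mul, e1, e2, e3, e4]
    rw [hP]
    simp only [Polynomial.mul_comp, Polynomial.add_comp, Polynomial.one_comp, Polynomial.pow_comp,
      Polynomial.X_comp, Polynomial.ofNat_comp, map_mul, map_pow, map_ofNat, map_one]
    ring
  rw [h2, ← Polynomial.comp_C_mul_X_coeff, Polynomial.pow_comp, ← h3, mul_pow, ← map_pow,
    Polynomial.coeff_C_mul]

theorem coeff_stepDistribution_nonneg (hr : 0 < r) (i : ℕ) : 0 ≤ (stepDistribution r).coeff i := by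
  rcases lt_or_ge 3 i with hi | hi
  · exact (Cubic.coeff_eq_zero hi).ge
  · rw [stepDistribution]
    interval_cases i
    · rw [Cubic.coeff_eq_d]; positivity
    · rw [Cubic.coeff_eq_c]; positivity
    · rw [Cubic.coeff_eq_b]; positivity
    · rw [Cubic.coeff_eq_a]; positivity

theorem sum_stepDistribution (g : ℕ → ℝ) : ∑ i ∈ range (2 + 2), (stepDistribution r).coeff i * g i =
    (2 * g 0 + 6 * r * g 1 + 6 * r ^ 2 * g 2 + 4 * r ^ 3 * g 3) / (3 * (1 + r) ^ 2) := by
  simp only [sum_range_succ, sum_range_zero, stepDistribution, Nat.reduceAdd,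
    Cubic.coeff_eq_a, Cubic.coeff_eq_b,
    Cubic.coeff_eq_c, Cubic.coeff_eq_d]
  by_cases h : 1 + r = 0
  · simp [h]
  · field_simp
    ring

theorem sum_coeff_stepDistribution (hr : 0 < r) (hsaddle : 4 * r ^ 3 + 3 * r ^ 2 = 1) :
    ∑ i ∈ range (2 + 2), (stepDistribution r).coeff i = 1 := by
  have h := sum_stepDistribution (r := r) fun _ => 1
  simp only [mul_one] at h
  rw [h, div_eq_one_iff_eq (by positivity)]
  linear_combination hsaddle

theorem mean_stepDistribution (hsaddle : 4 * r ^ 3 + 3 * r ^ 2 = 1) :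
    ∑ i ∈ range (2 + 2), (stepDistribution r).coeff i * ((i : ℝ) - 1) = 0 := by
  rw [sum_stepDistribution fun i => (i : ℝ) - 1, div_eq_zero_iff]
  left
  push_cast
  linear_combination 2 * hsaddle

theorem variance_stepDistribution (hr : 0 < r) (hsaddle : 4 * r ^ 3 + 3 * r ^ 2 = 1) :
    ∑ i ∈ range (2 + 2), (stepDistribution r).coeff i * ((i : ℝ) - 1) ^ 2 =
      2 * (1 - r) / (1 + r) := by
  rw [sum_stepDistribution fun i => ((i : ℝ) - 1) ^ 2, div_eq_div_iff (by positivity)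
    (by positivity)]
  push_cast
  linear_combination 4 * (1 + r) * hsaddle

theorem tendsto_sqrt_mul_stepDistribution (hr : 0 < r)
    (hsaddle : 4 * r ^ 3 + 3 * r ^ 2 = 1)
    (l : ℕ) :
    Tendsto (fun N : ℕ => √(N : ℝ) * ((stepDistribution r) ^ N).coeff (N - l)) atTop
      (𝓝 (1 / √(2 * π * (2 * (1 - r) / (1 + r))))) := by
  refine tendsto_sqrt_mul_coeff natDegree_stepDistribution (coeff_stepDistribution_nonneg hr)
    (sum_coeff_stepDistribution hr hsaddle) ?_ ?_ (mean_stepDistribution hsaddle)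
    (variance_stepDistribution hr hsaddle) l
  · rw [stepDistribution, Cubic.coeff_eq_d]; positivity
  · rw [stepDistribution, Cubic.coeff_eq_c]; positivity

theorem exists_sqrt_mul_stepDistribution_le (hr : 0 < r)
    (hsaddle : 4 * r ^ 3 + 3 * r ^ 2 = 1) :
    ∃ K : ℝ, ∀ N k : ℕ, ‖√(N : ℝ) * ((stepDistribution r) ^ N).coeff k‖ ≤ K := by
  refine exists_sqrt_mul_coeff_le natDegree_stepDistribution (coeff_stepDistribution_nonneg hr)
    (sum_coeff_stepDistribution hr hsaddle) ?_ ?_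
  · rw [stepDistribution, Cubic.coeff_eq_d]; positivity
  · rw [stepDistribution, Cubic.coeff_eq_c]; positivity

/-- The local limit theorem, averaged over the coefficients of the weight series. -/
theorem tendsto_sqrt_mul_coeff_weightSeries_mul (hr : 0 < r) (hr1 : r < 1)
    (hsaddle : 4 * r ^ 3 + 3 * r ^ 2 = 1) :
    Tendsto (fun m : ℕ => √((m + 2 : ℕ) : ℝ) *
      ((PowerSeries.coeff m (weightSeries * stepSeries ^ (m + 2)) : ℚ) : ℝ) * r ^ m /
        (3 * (1 + r) ^ 2 / 2) ^ (m + 2)) atTop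
      (𝓝 ((2 - 4 * r ^ 2 - 6 * r ^ 3) * ((1 + r)⁻¹ ^ 3 * (1 + r ^ 2)⁻¹ ^ 4) *
        (1 / √(2 * π * (2 * (1 - r) / (1 + r)))))) := by
  have hW := hasAbsValue_weightSeries hr.le hr1
  obtain ⟨K, hK⟩ := exists_sqrt_mul_stepDistribution_le hr hsaddle
  set L := 1 / √(2 * π * (2 * (1 - r) / (1 + r))) with hL
  rw [← hW.tsum_eq, ← tsum_mul_right]
  have hF : (3 * (1 + r) ^ 2 / 2) ≠ 0 := by positivity
  have hlim : Tendsto (fun m : ℕ => ∑' j, if j ∈ range (m + 1) then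
      ((PowerSeries.coeff j weightSeries : ℚ) : ℝ) * r ^ j *
        (√((m + 2 : ℕ) : ℝ) * ((stepDistribution r) ^ (m + 2)).coeff (m - j)) else 0) atTop
      (𝓝 (∑' j, ((PowerSeries.coeff j weightSeries : ℚ) : ℝ) * r ^ j * L)) := by
    refine tendsto_tsum_of_dominated_convergence (hW.summable.mul_right K) (fun j => ?_)
      (Eventually.of_forall fun m j => ?_)
    · have h := ((tendsto_sqrt_mul_stepDistribution hr hsaddle (j + 2)).comp
        (tendsto_add_atTop_nat 2)).const_mul (((PowerSeries.coeff j weightSeries : ℚ) : ℝ) * r ^ j)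
      refine h.congr' ?_
      filter_upwards [eventually_ge_atTop j] with m hm
      rw [if_pos (mem_range.2 (Nat.lt_succ_of_le hm)), Function.comp_apply,
        show m + 2 - (j + 2) = m - j by omega]
    · split_ifs
      · rw [norm_mul]
        exact mul_le_mul_of_nonneg_left (hK _ _) (norm_nonneg _)
      · rw [norm_zero]
        exact mul_nonneg (norm_nonneg _) ((norm_nonneg _).trans (hK 0 0))
  refine hlim.congr fun m => ?_
  rw [tsum_eq_sum (s := range (m + 1)) fun j hj => if_neg hj,
    sum_congr rfl fun j hj => if_pos hj, PowerSeries.coeff_mul,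
    Nat.sum_antidiagonal_eq_sum_range_succ_mk]
  push_cast
  rw [mul_sum, sum_mul, sum_div]
  refine sum_congr rfl fun j hj => ?_
  have hj' : j ≤ m := Nat.lt_succ_iff.1 (mem_range.1 hj)
  have h := coeff_stepDistribution_pow hr (m + 2) (m - j)
  have hpow : r ^ m = r ^ j * r ^ (m - j) := by
    rw [← pow_add, Nat.add_sub_cancel' hj']
  rw [eq_div_iff (pow_ne_zero _ hF), hpow]
  linear_combination (-(((PowerSeries.coeff j weightSeries : ℚ) : ℝ) * r ^ j *
    √((m : ℝ) + 2))) * h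

/-- The leading constant in the asymptotic formula, in terms of the saddle point. -/
theorem tendsto_numAvoiding (hr : 0 < r) (hr1 : r < 1)
    (hsaddle : 4 * r ^ 3 + 3 * r ^ 2 = 1) :
    Tendsto (fun m : ℕ => √((m + 2 : ℕ) : ℝ) *
      ((m + 1) * (m + 2) * (numAvoiding perm312 (m + 1) : ℝ)) /
        (3 * (1 + r) ^ 2 / (2 * r)) ^ (m + 1)) atTop
      (𝓝 (3 * r / (8 * (1 + r ^ 2) ^ 3 * √(π * (1 - r ^ 2))))) := by
  have h := (tendsto_sqrt_mul_coeff_weightSeries_mul hr hr1 hsaddle).const_mul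
    (r * (3 * (1 + r) ^ 2 / 2))
  have h1r : 0 < 1 - r := by linarith
  have h1r2 : 0 < 1 - r ^ 2 := by nlinarith
  have hsq : √(2 * π * (2 * (1 - r) / (1 + r))) = 2 * √(π * (1 - r ^ 2)) / (1 + r) := by
    rw [← Real.sqrt_sq (show 0 ≤ 2 * √(π * (1 - r ^ 2)) / (1 + r) by positivity), div_pow, mul_pow,
      Real.sq_sqrt (by positivity)]
    congr 1
    field_simp
    ring
  have hval : r * (3 * (1 + r) ^ 2 / 2) * ((2 - 4 * r ^ 2 - 6 * r ^ 3) *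
      ((1 + r)⁻¹ ^ 3 * (1 + r ^ 2)⁻¹ ^ 4) * (1 / √(2 * π * (2 * (1 - r) / (1 + r))))) =
      3 * r / (8 * (1 + r ^ 2) ^ 3 * √(π * (1 - r ^ 2))) := by
    have hs : √(π * (1 - r ^ 2)) ≠ 0 := (Real.sqrt_pos.2 (by positivity)).ne'
    rw [hsq, show 2 - 4 * r ^ 2 - 6 * r ^ 3 = (1 + r ^ 2) / 2 by
      linear_combination (-3 / 2) * hsaddle]
    field_simp
    norm_num
  rw [hval] at h
  refine h.congr fun m => ?_
  have hm : ((m : ℝ) + 1) * (m + 2) * (numAvoiding perm312 (m + 1) : ℝ) =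
      ((PowerSeries.coeff m (weightSeries * stepSeries ^ (m + 2)) : ℚ) : ℝ) := by
    rw [← numAvoiding_eq_coeff]
    push_cast
    ring
  have hb : (3 * (1 + r) ^ 2 / (2 * r)) ^ (m + 1) =
      (3 * (1 + r) ^ 2 / 2) ^ (m + 1) / (r ^ m * r) := by
    rw [← pow_succ, ← div_pow]
    congr 1
    field_simp
  rw [hm, hb]
  have hF : (3 * (1 + r) ^ 2 / 2) ≠ 0 := by positivity
  rw [pow_succ (3 * (1 + r) ^ 2 / 2) (m + 1)]
  generalize 3 * (1 + r) ^ 2 / 2 = F at hF ⊢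
  field_simp

theorem isEquivalent_numAvoiding (hr : 0 < r) (hr1 : r < 1)
    (hsaddle : 4 * r ^ 3 + 3 * r ^ 2 = 1) :
    Asymptotics.IsEquivalent atTop
    (fun n : ℕ => (numAvoiding perm312 n : ℝ))
    (fun n : ℕ => 3 * r / (8 * (1 + r ^ 2) ^ 3 * √(π * (1 - r ^ 2))) * (n : ℝ) ^ (-5 / 2 : ℝ) *
      (3 * (1 + r) ^ 2 / (2 * r)) ^ n) := by
  have h1r2 : 0 < 1 - r ^ 2 := by nlinarith
  have hδpos : 0 < 3 * r / (8 * (1 + r ^ 2) ^ 3 * √(π * (1 - r ^ 2))) := by positivity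
  have hρpos : 0 < 3 * (1 + r) ^ 2 / (2 * r) := by positivity
  have hlim := tendsto_numAvoiding hr hr1 hsaddle
  generalize 3 * r / (8 * (1 + r ^ 2) ^ 3 * √(π * (1 - r ^ 2))) = δ at hδpos hlim ⊢
  generalize 3 * (1 + r) ^ 2 / (2 * r) = ρ at hρpos hlim ⊢
  refine Asymptotics.isEquivalent_of_tendsto_one ?_
  rw [← tendsto_add_atTop_iff_nat 1]
  have hratio : Tendsto (fun m : ℕ => ((m : ℝ) + 1) / (m + 2)) atTop (𝓝 1) := by
    have h := (tendsto_natCast_div_add_atTop (1 : ℝ)).comp (tendsto_add_atTop_nat 1)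
    refine h.congr fun m => ?_
    simp only [Function.comp_apply]
    push_cast
    ring
  have hsqrt : Tendsto (fun m : ℕ => √(((m : ℝ) + 1) / (m + 2))) atTop (𝓝 1) := by
    have h := (Real.continuous_sqrt.tendsto 1).comp hratio
    rwa [Real.sqrt_one] at h
  have hfin := ((hlim.div_const δ).mul hratio).mul hsqrt
  rw [div_self hδpos.ne', one_mul, one_mul] at hfin
  refine hfin.congr fun m => ?_
  have hm1 : (0 : ℝ) < (m : ℝ) + 1 := by positivity
  have hm2 : (0 : ℝ) < (m : ℝ) + 2 := by positivity
  have hrpow : ((m : ℝ) + 1) ^ (-5 / 2 : ℝ) = (((m : ℝ) + 1) ^ 2 * √((m : ℝ) + 1))⁻¹ := by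
    rw [show (-5 / 2 : ℝ) = -(2 + 1 / 2) by norm_num, Real.rpow_neg hm1.le, Real.rpow_add hm1,
      Real.sqrt_eq_rpow, Real.rpow_two]
  have hs1 : √((m : ℝ) + 1) ≠ 0 := (Real.sqrt_pos.2 hm1).ne'
  have hs2 : √((m : ℝ) + 2) ≠ 0 := (Real.sqrt_pos.2 hm2).ne'
  have hρm := pow_ne_zero (m + 1) hρpos.ne'
  rw [Pi.div_apply, Real.sqrt_div hm1.le]
  push_cast
  rw [hrpow]
  field_simp

end Saddle

end SaddlePoint

section Constants

open scoped Real

/-! ### The growth rate and the leading constant -/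

/-- With `c ^ 3 = 9 + 6 √3`, the number `c - 3 / c` is the real root of `u ^ 3 + 9 u = 18`; so is
`2 - 2 r / (1 + r) ^ 2`, and the growth rate is expressed in terms of this root. -/
theorem rho312_eq {r : ℝ} (hr : 0 < r) (hsaddle : 4 * r ^ 3 + 3 * r ^ 2 = 1) :
    rho312 = 3 * (1 + r) ^ 2 / (2 * r) := by
  have hb : (0 : ℝ) < 9 + 6 * √3 := by positivity
  set c : ℝ := (9 + 6 * √3) ^ (1 / 3 : ℝ) with hc
  have hcpos : 0 < c := Real.rpow_pos_of_pos hb _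
  have hc2 : (9 + 6 * √3) ^ (2 / 3 : ℝ) = c ^ 2 := by
    rw [hc, ← Real.rpow_natCast, ← Real.rpow_mul hb.le]
    norm_num
  have hc3 : c ^ 3 = 9 + 6 * √3 := by
    rw [hc, ← Real.rpow_natCast, ← Real.rpow_mul hb.le]
    norm_num
  have h3 : √(3 : ℝ) ^ 2 = 3 := Real.sq_sqrt (by norm_num)
  have hc6 : c ^ 6 - 18 * c ^ 3 - 27 = 0 := by
    linear_combination (c ^ 3 + 9 + 6 * √3 - 18) * hc3 + 36 * h3
  have hu : (c - 3 / c) ^ 3 + 9 * (c - 3 / c) - 18 = 0 := by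
    field_simp
    linear_combination hc6
  have hw : (2 - 2 * r / (1 + r) ^ 2) ^ 3 + 9 * (2 - 2 * r / (1 + r) ^ 2) - 18 = 0 := by
    have h1 : (2 - 2 * r / (1 + r) ^ 2) ^ 3 + 9 * (2 - 2 * r / (1 + r) ^ 2) - 18 =
        (8 * (1 + r + r ^ 2) ^ 3 - 18 * r * (1 + r) ^ 4) / (1 + r) ^ 6 := by
      field_simp
      ring
    rw [h1, div_eq_zero_iff]
    left
    linear_combination (2 * r ^ 3 - 6 * r - 8) * hsaddle
  have heq : c - 3 / c = 2 - 2 * r / (1 + r) ^ 2 := by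
    generalize c - 3 / c = u at hu ⊢
    generalize 2 - 2 * r / (1 + r) ^ 2 = w at hw ⊢
    have h1 : (u - w) * (u ^ 2 + u * w + w ^ 2 + 9) = 0 := by
      linear_combination hu - hw
    have h2 : u ^ 2 + u * w + w ^ 2 + 9 ≠ 0 := by nlinarith [sq_nonneg (u + w), sq_nonneg u]
    exact sub_eq_zero.1 ((mul_eq_zero.1 h1).resolve_right h2)
  have hden : 3 + 2 * c - c ^ 2 = c * (2 * r / (1 + r) ^ 2) := by
    have h1 : c * (c - 3 / c) = c ^ 2 - 3 := by
      field_simp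
    linear_combination h1 - c * heq
  rw [rho312, ← hc, hc2, hden]
  field_simp

theorem abs_rho312_sub_lt : |rho312 - 6.97685| < 5 * 10 ^ (-6 : ℤ) := by
  obtain ⟨r, h1, h2, hs⟩ := exists_saddlePoint
  have hr : 0 < r := by linarith
  rw [rho312_eq hr hs, abs_lt]
  have h2r : 0 < 2 * r := by positivity
  constructor
  · rw [lt_sub_iff_add_lt, lt_div_iff₀ h2r]
    norm_num
    nlinarith
  · rw [sub_lt_iff_lt_add, div_lt_iff₀ h2r]
    norm_num
    nlinarith

theorem abs_leadingConstant_sub_lt {r : ℝ} (h1 : 0.4554100411 < r) (h2 : r < 0.4554100412) :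
    |3 * r / (8 * (1 + r ^ 2) ^ 3 * √(π * (1 - r ^ 2))) - 0.0614865| < 5 * 10 ^ (-8 : ℤ) := by
  have hr : 0 < r := by linarith
  have hπ1 := Real.pi_gt_d6
  have hπ2 := Real.pi_lt_d6
  have hsq1 : 0.4554100411 ^ 2 < r ^ 2 := by gcongr
  have hsq2 : r ^ 2 < 0.4554100412 ^ 2 := by gcongr
  have hs1 : 1.577983 < √(π * (1 - r ^ 2)) := by
    apply Real.lt_sqrt_of_sq_lt
    nlinarith
  have hs2 : √(π * (1 - r ^ 2)) < 1.577984 := by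
    rw [Real.sqrt_lt' (by norm_num)]
    nlinarith
  generalize √(π * (1 - r ^ 2)) = s at hs1 hs2
  have hspos : 0 < s := by linarith
  have hlow : 8 * (1 + 0.4554100411 ^ 2) ^ 3 * 1.577983 < 8 * (1 + r ^ 2) ^ 3 * s := by gcongr
  have hupp : 8 * (1 + r ^ 2) ^ 3 * s < 8 * (1 + 0.4554100412 ^ 2) ^ 3 * 1.577984 := by gcongr
  have hpos : 0 < 8 * (1 + r ^ 2) ^ 3 * s := by positivity
  generalize 8 * (1 + r ^ 2) ^ 3 * s = D at hlow hupp hpos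
  rw [abs_lt]
  constructor
  · rw [lt_sub_iff_add_lt, lt_div_iff₀ hpos]
    norm_num at hupp ⊢
    linarith
  · rw [sub_lt_iff_lt_add, div_lt_iff₀ hpos]
    norm_num at hlow ⊢
    linarith

end Constants

end SetPartitionPattern

end

open SetPartitionPattern in
theorem mainTheorem3 :
    Polynomial.aeval genFun312 cubic312 = 0 ∧
    IsAlgebraic (Polynomial ℚ) genFun312 ∧
    |rho312 - 6.97685| < 5 * 10 ^ (-6 : ℤ) ∧
    ∃ δ : ℝ, |δ - 0.0614865| < 5 * 10 ^ (-8 : ℤ) ∧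
      Asymptotics.IsEquivalent Filter.atTop
        (fun n : ℕ => (numAvoiding perm312 n : ℝ))
        (fun n : ℕ => δ * (n : ℝ) ^ (-5 / 2 : ℝ) * rho312 ^ n) := by
  obtain ⟨r, h1, h2, hs⟩ := exists_saddlePoint
  have hr : 0 < r := by linarith
  refine ⟨aeval_cubic312, isAlgebraic_genFun312, abs_rho312_sub_lt, _,
    abs_leadingConstant_sub_lt h1 h2, ?_⟩
  rw [rho312_eq hr hs]
  exact isEquivalent_numAvoiding hr (by linarith) hs
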